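/- **Definitions.** A function $F:[0,\infty)^4\to[0,\infty)$ is *permissible* if it is nondecreasing for the coordinatewise order and $x l_y+y l_x\le F(x,y,l_x,l_y)$ for all $x,y,l_x,l_y\ge 0$; it is *strongly permissible* if moreover $F$ is continuous and $\lambda\mu F(x,y,l_x,l_y)\le F(\lambda x,\mu y,\lambda l_x,\mu l_y)$ for all $x,y,l_x,l_y,\lambda,\mu\ge 0$. An *$F$-quasi-Leibniz quantum compact metric space* $(\mathfrak A,\mathsf L)$ is a nonzero unital C\*-algebra $\mathfrak A$ with a seminorm $\mathsf L$ defined on a dense real subspace $\operatorname{dom}(\mathsf L)$ of the self-adjoint part $\mathfrak{sa}(\mathfrak A)$ that is closed under the products $a\circ b=\frac{ab+ba}{2}$ and $\{a,b\}=\frac{ab-ba}{2i}$ (put $\mathsf L=\infty$ off $\operatorname{dom}(\mathsf L)$), such that: (1) $\mathsf L(a)=0$ if and only if $a\in\mathbb R 1_{\mathfrak A}$; (2) the Lip-ball $\{a\in\mathfrak{sa}(\mathfrak A):\mathsf L(a)\le1\}$ is norm closed; (3) the Monge–Kantorovich metric $\mathrm{mk}_{\mathsf L}(\varphi,\psi)=\sup\{|\varphi(a)-\psi(a)|:\mathsf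 L(a)\le 1\}$ on the state space $\mathscr S(\mathfrak A)$ is a metric inducing the weak\* topology; (4) $\mathsf L(a\circ b)$ and $\mathsf L(\{a,b\})$ are at most $F(\|a\|,\|b\|,\mathsf L(a),\mathsf L(b))$ for all $a,b\in\operatorname{dom}(\mathsf L)$. An *$F$-tunnel* from $(\mathfrak A_1,\mathsf L_1)$ to $(\mathfrak A_2,\mathsf L_2)$ is an $F$-quasi-Leibniz quantum compact metric space $(\mathfrak D,\mathsf L_{\mathfrak D})$ with surjective \*-morphisms $\pi_j:\mathfrak D\to\mathfrak A_j$ such that $\mathsf L_j(a)=\inf\{\mathsf L_{\mathfrak D}(d):d\in\mathfrak{sa}(\mathfrak D),\ \pi_j(d)=a\}$ for all $a\in\mathfrak{sa}(\mathfrak A_j)$, $j=1,2$. Its *extent* is the maximum over $j\in\{1,2\}$ of the Hausdorff distance, for $\mathrm{mk}_{\mathsf L_{\mathfrak D}}$, between $\mathscr S(\mathfrak D)$ and $\{\varphi\circ\pi_j:\varphi\in\mathscr S(\mathfrak A_j)\}$. The *dual propinquity* $\Lambda_F$ between two $F$-quasi-Leibniz quantum compact metric spaces is the infimum of the extents of all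 $F$-tunnels from the first to the second. Its topology is the one in which a class $U$ is open when for each $X\in U$ there is $\varepsilon>0$ with $\{Y:\Lambda_F(X,Y)<\varepsilon\}\subseteq U$. **Theorem.** Let $F$ be strongly permissible, let $d\ge1$ be an integer and let $K>0$ be real. Let $\mathcal C_{F,K,d}$ be the class of all $F$-quasi-Leibniz quantum compact metric spaces $(\mathfrak A,\mathsf L)$ such that $\dim_{\mathbb C}\mathfrak A\le d$ and the diameter of $\mathscr S(\mathfrak A)$ for $\mathrm{mk}_{\mathsf L}$ is at most $K$. Then $\mathcal C_{F,K,d}$ is compact for the dual propinquity $\Lambda_F$: it is compact in the topology of $\Lambda_F$, and every sequence in $\mathcal C_{F,K,d}$ has a subsequence $(\mathfrak A_n,\mathsf L_n)_{n\in\mathbb N}$ which converges for $\Lambda_F$ to some $(\mathfrak A,\mathsf L)\in\mathcal C_{F,K,d}$. Moreover, the subsequence and the limit can be chosen so that there are injective (not necessarily unital) \*-morphisms $\pi_n:\mathfrak A_n\to M_d(\mathbb C)$ and $\rho:\mathfrak A\to M_d(\mathbb C)$ with $\pi_n(1_{\mathfrak A_n})=\rho(1_{\mathfrak A})$ for all $n$,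 and a closed set $S\subseteq\rho(\mathfrak{sa}(\mathfrak A))$, such that the images $\pi_n(\{a\in\mathfrak{sa}(\mathfrak A_n):\mathsf L_n(a)\le1\})$ of the Lip-balls converge to $S$ for the Hausdorff distance of the operator norm, and $\mathsf L$ is the Minkowski functional of $S$: $\mathsf L(a)=\inf\{r>0:\rho(a)\in rS\}$ for all $a\in\mathfrak{sa}(\mathfrak A)$. -/

import Mathlib

open scoped ENNReal NNReal ComplexOrder ComplexStarModule CStarAlgebra Pointwise Topology
open Filter

universe u

noncomputable section

/-! ### Permissible functions -/

/-- A function `F : [0,∞)⁴ → [0,∞)` is permissible when it is nondecreasing for the coordinatewise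
order and `x * l_y + y * l_x ≤ F (x, y, l_x, l_y)`. -/
structure Permissible (F : ℝ≥0 × ℝ≥0 × ℝ≥0 × ℝ≥0 → ℝ≥0) : Prop where
  monotone : Monotone F
  le_apply : ∀ x y lx ly : ℝ≥0, x * ly + y * lx ≤ F (x, y, lx, ly)

/-- A permissible function is strongly permissible when it is moreover continuous and
`λ μ F (x, y, l_x, l_y) ≤ F (λ x, μ y, λ l_x, μ l_y)`. -/
structure StronglyPermissible (F : ℝ≥0 × ℝ≥0 × ℝ≥0 × ℝ≥0 → ℝ≥0) : Prop
    extends Permissible F where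
  continuous : Continuous F
  mul_le : ∀ x y lx ly s t : ℝ≥0, s * t * F (x, y, lx, ly) ≤ F (s * x, t * y, s * lx, t * ly)

/-! ### States, Jordan and Lie products -/

section Algebra

variable {A B : Type u} [CStarAlgebra A] [CStarAlgebra B]

/-- The Jordan product `(a b + b a) / 2` of two self-adjoint elements. -/
def jordanProd (a b : selfAdjoint A) : selfAdjoint A :=
  ⟨(1 / 2 : ℂ) • ((a : A) * b + b * a), by
    have ha : star (a : A) = a := a.2
    have hb : star (b : A) = b := b.2
    simp [selfAdjoint.mem_iff, star_smul, ha, hb, add_comm]⟩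

/-- The Lie product `(a b - b a) / (2 i)` of two self-adjoint elements. -/
def lieProd (a b : selfAdjoint A) : selfAdjoint A :=
  ⟨(1 / (2 * Complex.I) : ℂ) • ((a : A) * b - b * a), by
    have ha : star (a : A) = a := a.2
    have hb : star (b : A) = b := b.2
    rw [selfAdjoint.mem_iff, star_smul, star_sub, star_mul, star_mul, ha, hb,
      ← neg_sub, smul_neg, ← neg_smul]
    simp⟩

variable (A) in
/-- The state space of a unital C*-algebra: the positive linear functionals of value `1` at the
unit, with the weak* topology (the subspace topology of `WeakDual ℂ A`). -/
abbrev StateSpace : Type u :=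
  {φ : WeakDual ℂ A // φ 1 = 1 ∧ ∀ a : A, 0 ≤ φ (star a * a)}

/-- The map `π^* : 𝒮(B) → 𝒮(A)`, `φ ↦ φ ∘ π`, dual to a unital *-morphism `π : A → B`. -/
def StateSpace.comap (π : A →⋆ₐ[ℂ] B) (φ : StateSpace B) : StateSpace A :=
  ⟨StrongDual.toWeakDual
      ((WeakDual.toStrongDual φ.1).comp (⟨π.toAlgHom.toLinearMap, map_continuous π⟩ : A →L[ℂ] B)), by
    refine ⟨?_, fun a => ?_⟩
    · change φ.1 (π 1) = 1
      rw [map_one]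
      exact φ.2.1
    · change 0 ≤ φ.1 (π (star a * a))
      rw [map_mul, map_star]
      exact φ.2.2 (π a)⟩

/-- The Monge-Kantorovich distance
`mk_L(φ, ψ) = sup {|φ(a) - ψ(a)| : L(a) ≤ 1}` between two states. -/
def mongeKantorovich (L : selfAdjoint A → ℝ≥0∞) (φ ψ : StateSpace A) : ℝ≥0∞ :=
  ⨆ (a : selfAdjoint A) (_ : L a ≤ 1), edist (φ.1 (a : A)) (ψ.1 (a : A))

/-- The state space with the Monge-Kantorovich distance. -/
@[reducible]
def mongeKantorovichSpace (L : selfAdjoint A → ℝ≥0∞) : PseudoEMetricSpace (StateSpace A) where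
  edist := mongeKantorovich L
  edist_self φ := by simp [mongeKantorovich]
  edist_comm φ ψ := by simp [mongeKantorovich, edist_comm]
  edist_triangle φ ψ θ := by
    refine iSup₂_le fun a ha => (edist_triangle _ (ψ.1 (a : A)) _).trans (add_le_add ?_ ?_)
    · exact le_iSup₂ (f := fun (a : selfAdjoint A) (_ : L a ≤ 1) =>
        edist (φ.1 (a : A)) (ψ.1 (a : A))) a ha
    · exact le_iSup₂ (f := fun (a : selfAdjoint A) (_ : L a ≤ 1) =>
        edist (ψ.1 (a : A)) (θ.1 (a : A))) a ha

/-- `L` is an `F`-quasi-Leibniz Lip-norm on the unital C*-algebra `A`. A seminorm with domain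
`dom L ⊆ sa(A)` is given by its extension to `sa(A)` with the value `∞` off the domain, so that
`dom L = {a | L a < ∞}`. By `add_le` and `smul` this is a real subspace on which `L` is a
seminorm; by `jordan_le` and `lie_le` it is stable under the Jordan and the Lie product. -/
structure IsQuasiLeibnizLipNorm (F : ℝ≥0 × ℝ≥0 × ℝ≥0 × ℝ≥0 → ℝ≥0)
    (L : selfAdjoint A → ℝ≥0∞) : Prop where
  add_le : ∀ a b, L (a + b) ≤ L a + L b
  smul : ∀ (r : ℝ) (a), L (r • a) = ENNReal.ofReal |r| * L a
  dense_dom : Dense {a | L a < ∞}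
  eq_zero_iff : ∀ a, L a = 0 ↔ ∃ t : ℝ, a = t • (1 : selfAdjoint A)
  isClosed_ball : IsClosed {a | L a ≤ 1}
  /-- the Monge-Kantorovich metric is finite and induces the weak* topology -/
  mongeKantorovich_lt_top : ∀ φ ψ : StateSpace A, mongeKantorovich L φ ψ < ∞
  induces_weakStar : (mongeKantorovichSpace L).toUniformSpace.toTopologicalSpace =
    (inferInstance : TopologicalSpace (StateSpace A))
  jordan_le : ∀ a b, L a < ∞ → L b < ∞ →
    L (jordanProd a b) ≤ F (‖(a : A)‖₊, ‖(b : A)‖₊, (L a).toNNReal, (L b).toNNReal)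
  lie_le : ∀ a b, L a < ∞ → L b < ∞ →
    L (lieProd a b) ≤ F (‖(a : A)‖₊, ‖(b : A)‖₊, (L a).toNNReal, (L b).toNNReal)

end Algebra

/-! ### Quasi-Leibniz quantum compact metric spaces, tunnels, and the dual propinquity -/

/-- An `F`-quasi-Leibniz quantum compact metric space: a (nonzero) unital C*-algebra with an
`F`-quasi-Leibniz Lip-norm. -/
structure QQCMS (F : ℝ≥0 × ℝ≥0 × ℝ≥0 × ℝ≥0 → ℝ≥0) : Type (u + 1) where
  Alg : Type u
  [cstar : CStarAlgebra Alg]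
  [nontrivial : Nontrivial Alg]
  L : selfAdjoint Alg → ℝ≥0∞
  isLipNorm : IsQuasiLeibnizLipNorm F L

attribute [instance] QQCMS.cstar QQCMS.nontrivial

variable {F : ℝ≥0 × ℝ≥0 × ℝ≥0 × ℝ≥0 → ℝ≥0}

/-- The diameter of the state space for the Monge-Kantorovich metric. -/
def QQCMS.stateDiam (X : QQCMS.{u} F) : ℝ≥0∞ :=
  ⨆ (φ : StateSpace X.Alg) (ψ : StateSpace X.Alg), mongeKantorovich X.L φ ψ

/-- An `F`-tunnel from `X` to `Y`: an `F`-quasi-Leibniz quantum compact metric space `D` with two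
*-epimorphisms onto `X` and `Y`, whose Lip-norm has the Lip-norms of `X` and `Y` as quotients. -/
structure Tunnel (X Y : QQCMS.{u} F) : Type (u + 1) where
  D : QQCMS.{u} F
  π₁ : D.Alg →⋆ₐ[ℂ] X.Alg
  π₂ : D.Alg →⋆ₐ[ℂ] Y.Alg
  surjective₁ : Function.Surjective π₁
  surjective₂ : Function.Surjective π₂
  quotient₁ : ∀ a : selfAdjoint X.Alg,
    X.L a = ⨅ (d : selfAdjoint D.Alg) (_ : π₁ (d : D.Alg) = a), D.L d
  quotient₂ : ∀ b : selfAdjoint Y.Alg,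
    Y.L b = ⨅ (d : selfAdjoint D.Alg) (_ : π₂ (d : D.Alg) = b), D.L d

/-- The Hausdorff distance of two sets of states for the Monge-Kantorovich metric. -/
def QQCMS.hausdorff (X : QQCMS.{u} F) (S T : Set (StateSpace X.Alg)) : ℝ≥0∞ :=
  letI := mongeKantorovichSpace X.L
  Metric.hausdorffEDist S T

/-- The extent of a tunnel. -/
def Tunnel.extent {X Y : QQCMS.{u} F} (τ : Tunnel X Y) : ℝ≥0∞ :=
  max (τ.D.hausdorff Set.univ (Set.range (StateSpace.comap τ.π₁)))
    (τ.D.hausdorff Set.univ (Set.range (StateSpace.comap τ.π₂)))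

/-- The dual Gromov-Hausdorff propinquity `Λ_F(X, Y)`. -/
def propinquity (X Y : QQCMS.{u} F) : ℝ≥0∞ :=
  ⨅ τ : Tunnel X Y, τ.extent

variable (F) in
/-- The topology of the dual propinquity: `U` is open when it contains, with each of its points, a
ball `{Y | Λ_F(X, Y) < ε}` of positive radius around it. -/
@[reducible]
def propinquityTopology : TopologicalSpace (QQCMS.{u} F) where
  IsOpen U := ∀ X ∈ U, ∃ ε : ℝ≥0∞, 0 < ε ∧ ∀ Y, propinquity X Y < ε → Y ∈ U
  isOpen_univ _ _ := ⟨1, one_pos, fun _ _ => trivial⟩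
  isOpen_inter U V hU hV X hX := by
    obtain ⟨ε, hε, h⟩ := hU X hX.1
    obtain ⟨δ, hδ, h'⟩ := hV X hX.2
    exact ⟨min ε δ, lt_min hε hδ, fun Y hY =>
      ⟨h Y (hY.trans_le (min_le_left _ _)), h' Y (hY.trans_le (min_le_right _ _))⟩⟩
  isOpen_sUnion S hS X hX := by
    obtain ⟨U, hU, hXU⟩ := hX
    obtain ⟨ε, hε, h⟩ := hS U hU X hXU
    exact ⟨ε, hε, fun Y hY => ⟨U, hU, h Y hY⟩⟩

variable (F) in
/-- The class of all `(𝔄, L)` with `dim_ℂ 𝔄 ≤ d` and state-space diameter at most `K`. -/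
def boundedClass (K : ℝ) (d : ℕ) : Set (QQCMS.{u} F) :=
  {X | Module.rank ℂ X.Alg ≤ d ∧ X.stateDiam ≤ ENNReal.ofReal K}

/-- The Lip-ball `{a ∈ sa(𝔄) : L(a) ≤ 1}`, pushed into a C*-algebra `M` by a *-morphism. -/
def QQCMS.lipBallImage {M : Type} [CStarAlgebra M] (X : QQCMS.{u} F) (π : X.Alg →⋆ₙₐ[ℂ] M) :
    Set M :=
  (fun a : selfAdjoint X.Alg => π (a : X.Alg)) '' {a | X.L a ≤ 1}

/-- `Y` is realized as a Hausdorff limit of the `x n` inside the algebra of `d × d` matrices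
(with the operator norm): all the algebras embed in it by (not necessarily unital)
*-monomorphisms which send their units to one projection, the Lip-balls of the `x n` converge for
the Hausdorff distance to a closed set `S` of self-adjoint elements of the algebra of `Y`, and the
Lip-norm of `Y` is the Minkowski functional of `S`. -/
def IsMatrixHausdorffLimit (d : ℕ) (x : ℕ → QQCMS.{u} F) (Y : QQCMS.{u} F) : Prop :=
  ∃ (π : ∀ n, (x n).Alg →⋆ₙₐ[ℂ] CStarMatrix (Fin d) (Fin d) ℂ)
    (ρ : Y.Alg →⋆ₙₐ[ℂ] CStarMatrix (Fin d) (Fin d) ℂ)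
    (S : Set (CStarMatrix (Fin d) (Fin d) ℂ)),
    (∀ n, Function.Injective (π n)) ∧ Function.Injective ρ ∧ (∀ n, π n 1 = ρ 1) ∧
    IsClosed S ∧ S ⊆ ρ '' {a | IsSelfAdjoint a} ∧
    Tendsto (fun n => Metric.hausdorffEDist ((x n).lipBallImage (π n)) S) atTop (𝓝 0) ∧
    ∀ a : selfAdjoint Y.Alg,
      Y.L a = ⨅ (r : ℝ≥0) (_ : 0 < r ∧ ρ (a : Y.Alg) ∈ (r : ℝ) • S), (r : ℝ≥0∞)

end

/-! Only finitely many dimensions occur, so an ultrafilter on the class concentrates on spaces of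
one dimension `m`. The GNS representation of a faithful state embeds each of these unitally in the
`m × m` matrices `M` (`exists_injective_starAlgHom_cstarMatrix`). All Lip-balls then sit in one
finite-dimensional space, and modulo scalars they lie in the ball of radius `K`
(`QQCMS.norm_sub_le`). They therefore converge along the ultrafilter, with no separate appeal to a
selection theorem for compact sets.

The limit space is read off from the limit of the balls. Its Lip-norm is the Minkowski functional of
that closed convex set. Continuity of `F` carries the Leibniz inequalities to the limit
(`lipLimitNorm_prod_le`), so the complex span of the limit ball is a unital star-subalgebra. The
bound modulo scalars makes the kernel exactly the scalars (`lipLimitNorm_eq_zero_iff`). The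
dimension cannot go up, because linear independence is an open condition, and the diameter bound
survives by transporting states.

Hausdorff closeness of Lip-balls gives closeness for the propinquity (`propinquity_le_of_lipBall`):
if the balls of `X` and `Y` are within `ε` in `M`, then `max (L_X a) (L_Y b) (‖π a - ρ b‖ / ε)` on
`X × Y` defines a tunnel. Its extent is at most `ε`, by a Hahn-Banach argument which moves a state
from one subalgebra to another at the cost of the norm distance (`StateSpace.exists_norm_sub_le`).

Compactness is then the ultrafilter criterion. For sequences one takes a nonprincipal ultrafilter on
the indices and extracts a subsequence. A corner embedding of `M` in the `d × d` matrices sends all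
units to the same projection. -/

section

variable {F : ℝ≥0 × ℝ≥0 × ℝ≥0 × ℝ≥0 → ℝ≥0}

/-! ### States as normalized real functionals; Hahn-Banach transport of states -/

section States

variable {A : Type u} [CStarAlgebra A]

/-- A positive element `b = a⋆ a` satisfies `‖‖b‖ - b‖ ≤ ‖b‖`. -/
theorem norm_algebraMap_sub_star_mul_self_le (a : A) :
    ‖algebraMap ℝ A ‖star a * a‖ - star a * a‖ ≤ ‖star a * a‖ := by
  have h := (SpectrumRestricts.nnreal_iff_nnnorm (a := star a * a) (t := ‖star a * a‖₊)
    (IsSelfAdjoint.star_mul_self a) le_rfl).1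
    (SpectrumRestricts.nnreal_iff.2 spectrum_star_mul_self_nonneg)
  exact_mod_cast h

/-- A real functional of norm at most one on the self-adjoint part which is normalized at the unit
is the restriction of a state. -/
theorem exists_state_of_real (f : selfAdjoint A →ₗ[ℝ] ℝ) (h1 : f 1 = 1)
    (hf : ∀ a, f a ≤ ‖a‖) : ∃ φ : StateSpace A, ∀ a : selfAdjoint A, φ.1 (a : A) = (f a : ℂ) := by
  have habs : ∀ a, |f a| ≤ ‖a‖ := fun a => abs_le.2
    ⟨by have := hf (-a); rw [map_neg, norm_neg] at this; linarith, hf a⟩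
  let g : A →ₗ[ℂ] ℂ :=
    { toFun := fun a => (f (ℜ a) : ℂ) + Complex.I * (f (ℑ a) : ℂ)
      map_add' := fun a b => by simp only [map_add]; push_cast; ring
      map_smul' := fun z a => by
        simp only [realPart_smul, imaginaryPart_smul, map_sub, map_add, map_smul, smul_eq_mul,
          RingHom.id_apply]
        apply Complex.ext <;> simp }
  have hg : ∀ a, ‖g a‖ ≤ 2 * ‖a‖ := fun a => by
    have hr : |f (ℜ a)| ≤ ‖a‖ := (habs _).trans (realPart.norm_le a)
    have hi : |f (ℑ a)| ≤ ‖a‖ := (habs _).trans (imaginaryPart.norm_le a)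
    calc ‖g a‖ ≤ ‖(f (ℜ a) : ℂ)‖ + ‖Complex.I * (f (ℑ a) : ℂ)‖ := norm_add_le _ _
      _ = |f (ℜ a)| + |f (ℑ a)| := by simp
      _ ≤ 2 * ‖a‖ := by linarith
  have hsa : ∀ a : selfAdjoint A, g a = (f a : ℂ) := fun a => by
    have hre : ℜ (a : A) = a := Subtype.ext (IsSelfAdjoint.coe_realPart a.2)
    have him : ℑ (a : A) = 0 := IsSelfAdjoint.imaginaryPart a.2
    change (f (ℜ (a : A)) : ℂ) + Complex.I * (f (ℑ (a : A)) : ℂ) = _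
    simp [hre, him]
  refine ⟨⟨StrongDual.toWeakDual (g.mkContinuous 2 hg), ?_, fun a => ?_⟩, hsa⟩
  · have := hsa 1
    rw [h1] at this
    simpa using this
  · let b : selfAdjoint A := ⟨star a * a, IsSelfAdjoint.star_mul_self a⟩
    -- Positivity comes from the norm bound and the normalization alone: with `n = ‖star a * a‖`,
    -- the value at `n • 1 - b` is `n - f b` and is at most `n`.
    have hb := hf (‖star a * a‖ • 1 - b)
    have hn : ‖‖star a * a‖ • (1 : selfAdjoint A) - b‖ ≤ ‖star a * a‖ := by
      have := norm_algebraMap_sub_star_mul_self_le a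
      rwa [Algebra.algebraMap_eq_smul_one] at this
    rw [map_sub, map_smul, h1, smul_eq_mul, mul_one] at hb
    have h0 : 0 ≤ f b := by linarith
    change 0 ≤ g (star a * a)
    rw [show g (star a * a) = (f b : ℂ) from hsa b]
    exact_mod_cast h0

/-- The restriction of a state to the self-adjoint part is real. -/
theorem StateSpace.exists_real (φ : StateSpace A) :
    ∃ f : selfAdjoint A →ₗ[ℝ] ℝ, f 1 = 1 ∧ (∀ a, f a ≤ ‖a‖) ∧
      ∀ a : selfAdjoint A, φ.1 (a : A) = (f a : ℂ) := by
  let _ := CStarAlgebra.spectralOrder A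
  have := CStarAlgebra.spectralOrderedRing A
  have hpos : ∀ a : A, 0 ≤ a → 0 ≤ φ.1 a := fun a ha => by
    obtain ⟨b, rfl⟩ := CStarAlgebra.nonneg_iff_eq_star_mul_self.1 ha
    exact φ.2.2 b
  -- Positivity at `‖a‖ • 1 - a` yields at once that the value at `a` is real and that it is at most
  -- `‖a‖`.
  have hle : ∀ a : selfAdjoint A, 0 ≤ φ.1 ((‖a‖ : ℂ) • (1 : A) - a) := fun a => hpos _ <| by
    have := IsSelfAdjoint.le_algebraMap_norm_self a.2
    rw [Algebra.algebraMap_eq_smul_one] at this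
    rw [sub_nonneg]
    exact_mod_cast this
  have hre : ∀ a : selfAdjoint A, φ.1 (a : A) = ((φ.1 (a : A)).re : ℂ) ∧ (φ.1 (a : A)).re ≤ ‖a‖ := by
    intro a
    have h := hle a
    rw [map_sub, map_smul, φ.2.1, smul_eq_mul, mul_one, Complex.le_def] at h
    refine ⟨Complex.ext rfl ?_, ?_⟩
    · have := h.2; simp at this; simp [this]
    · have := h.1; simp at this; exact this
  refine ⟨⟨⟨fun a => (φ.1 (a : A)).re, fun a b => ?_⟩, fun r a => ?_⟩, ?_, fun a => (hre a).2,
    fun a => (hre a).1⟩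
  · simp
  · have : ((r • a : selfAdjoint A) : A) = (r : ℂ) • (a : A) := by simp
    change (φ.1 ((r • a : selfAdjoint A) : A)).re = r * (φ.1 (a : A)).re
    rw [this, map_smul]; simp
  · change (φ.1 (1 : A)).re = 1
    rw [φ.2.1]; rfl

/-- Given two unital C*-subalgebras of a C*-algebra, every state of the one has a companion on the
other, which differs from it by at most the norm distance. -/
theorem StateSpace.exists_norm_sub_le {B M : Type*} [CStarAlgebra B] [CStarAlgebra M]
    {β : B →⋆ₐ[ℂ] M} (hβ : Function.Injective β) (α : A →⋆ₐ[ℂ] M) (φ : StateSpace B) :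
    ∃ ψ : StateSpace A, ∀ (a : selfAdjoint A) (b : selfAdjoint B),
      ‖φ.1 (b : B) - ψ.1 (a : A)‖ ≤ ‖β b - α a‖ := by
  obtain ⟨f, hf1, hf, hfφ⟩ := φ.exists_real
  -- Hahn-Banach on the product: `f` is placed on `0 × B` and dominated by the seminorm `‖β b - α
  -- a‖`. The extension `g` gives the companion as `a ↦ -g (a, 0)`. It has value one at the unit
  -- because the seminorm vanishes at `(1, 1)`.
  let p : (selfAdjoint A × selfAdjoint B) →ₗ.[ℝ] ℝ :=
    { domain := Submodule.prod ⊥ ⊤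
      toFun := (f ∘ₗ LinearMap.snd ℝ _ _) ∘ₗ Submodule.subtype _ }
  obtain ⟨g, hgf, hg⟩ := exists_extension_of_le_sublinear p
    (fun x => ‖β x.2 - α x.1‖) (fun c hc x => by
      have : β ((c • x).2 : B) - α ((c • x).1 : A) = (c : ℂ) • (β x.2 - α x.1) := by
        rw [smul_sub, ← map_smul, ← map_smul]; simp
      simp only [this, norm_smul]
      simp [abs_of_pos hc]) (fun x y => by
      have : β ((x + y).2 : B) - α ((x + y).1 : A) = (β x.2 - α x.1) + (β y.2 - α y.1) := by
        simp; abel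
      simp only [this]
      exact norm_add_le _ _) (by
      rintro ⟨⟨a, b⟩, h⟩
      have ha : a = 0 := by simpa using h.1
      subst ha
      change f b ≤ ‖β (b : B) - α ((0 : selfAdjoint A) : A)‖
      simpa [NonUnitalStarAlgHom.norm_map β hβ] using hf b)
  have hgB : ∀ b, g (0, b) = f b := fun b => hgf ⟨(0, b), rfl, trivial⟩
  have hsplit : ∀ a b, g (a, b) = f b + g (a, 0) := fun a b => by
    rw [← hgB, ← map_add]; simp
  have hneg : ∀ a b, |g (a, b)| ≤ ‖β (b : B) - α (a : A)‖ := fun a b => by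
    refine abs_le.2 ⟨?_, hg (a, b)⟩
    have := hg (-(a, b))
    rw [map_neg] at this
    have h2 : β ((-(a, b)).2 : B) - α ((-(a, b)).1 : A) = -(β b - α a) := by simp; abel
    simp only [h2, norm_neg] at this
    linarith
  obtain ⟨ψ, hψ⟩ := exists_state_of_real (-(g ∘ₗ LinearMap.inl ℝ _ _)) (by
    have h := hneg 1 1
    rw [hsplit 1 1, hf1, selfAdjoint.val_one, selfAdjoint.val_one, map_one, map_one, sub_self,
      norm_zero, abs_nonpos_iff] at h
    change -g (1, 0) = 1
    linarith) (fun a => by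
    have h := hneg a 0
    have h3 : ‖α (a : A)‖ ≤ ‖a‖ := NonUnitalStarAlgHom.norm_apply_le α (a : A)
    rw [ZeroMemClass.coe_zero, map_zero, zero_sub, norm_neg] at h
    exact neg_le.1 (abs_le.1 (h.trans h3)).1)
  refine ⟨ψ, fun a b => ?_⟩
  rw [hψ, hfφ, ← Complex.ofReal_sub, Complex.norm_real, Real.norm_eq_abs]
  refine le_trans (le_of_eq ?_) (hneg a b)
  rw [hsplit]; simp

/-- Every self-adjoint element is normed by a state. -/
theorem exists_state_norm_eq [Nontrivial A] (a : selfAdjoint A) :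
    ∃ φ : StateSpace A, ‖φ.1 (a : A)‖ = ‖a‖ := by
  have : IsStarNormal (a : A) := a.2.isStarNormal
  -- In the commutative algebra generated by `a`, a character attains the spectral radius, which is
  -- the norm.
  let B := StarAlgebra.elemental ℂ (a : A)
  let b : B := ⟨a, StarAlgebra.elemental.self_mem ℂ (a : A)⟩
  have hb : IsSelfAdjoint b := Subtype.ext a.2
  obtain ⟨z, hz, hzb⟩ := spectrum.exists_nnnorm_eq_spectralRadius b
  rw [hb.spectralRadius_eq_nnnorm] at hzb
  obtain ⟨χ, hχ⟩ := WeakDual.CharacterSpace.mem_spectrum_iff_exists.1 hz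
  let φ : StateSpace B := ⟨WeakDual.CharacterSpace.toCLM χ, map_one χ, fun c => by
    change 0 ≤ χ (star c * c)
    rw [map_mul, map_star]
    exact star_mul_self_nonneg _⟩
  -- With the inclusion of `B` and the identity of `A`, the companion agrees with the character on
  -- `a`, where the norm distance is zero.
  obtain ⟨ψ, hψ⟩ := φ.exists_norm_sub_le (β := B.subtype) Subtype.val_injective
    (StarAlgHom.id ℂ A)
  refine ⟨ψ, ?_⟩
  have := hψ a ⟨b, hb⟩
  have h0 : φ.1 b = ψ.1 (a : A) := by
    rw [← sub_eq_zero, ← norm_le_zero_iff]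
    exact this.trans (by simp [b, B])
  rw [← h0]
  change ‖χ b‖ = _
  rw [hχ]
  exact congrArg NNReal.toReal (ENNReal.coe_injective hzb)

end States

/-! ### Faithful states, the GNS representation, and corners of matrix algebras -/

section RegularRepresentation

variable {A : Type u} [CStarAlgebra A]

theorem StateSpace.map_star (φ : StateSpace A) (a : A) : φ.1 (star a) = star (φ.1 a) := by
  obtain ⟨f, -, -, h⟩ := φ.exists_real
  have h1 : φ.1 a = f (ℜ a) + Complex.I * f (ℑ a) := by
    conv_lhs => rw [← realPart_add_I_smul_imaginaryPart a]
    rw [map_add, map_smul, h, h, smul_eq_mul]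
  have h2 : φ.1 (star a) = f (ℜ a) - Complex.I * f (ℑ a) := by
    conv_lhs => rw [← realPart_add_I_smul_imaginaryPart a]
    rw [star_add, star_smul, selfAdjoint.star_val_eq, selfAdjoint.star_val_eq, map_add, map_smul,
      h, h, smul_eq_mul]
    simp [sub_eq_add_neg]
  rw [h1, h2]
  simp [sub_eq_add_neg]

/-- A finite-dimensional C*-algebra has a faithful state. -/
theorem exists_faithful_state [FiniteDimensional ℂ A] [Nontrivial A] :
    ∃ φ : StateSpace A, ∀ a : A, φ.1 (star a * a) = 0 → a = 0 := by
  -- The state is the normalized trace of left multiplication. The roots of the characteristic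
  -- polynomial of that operator are the spectrum of the element, so on `star a * a` the trace is a
  -- sum of nonnegative numbers, one of which has modulus `‖star a * a‖`.
  let τ : A →ₗ[ℂ] ℂ := LinearMap.trace ℂ A ∘ₗ (Algebra.lmul ℂ A).toLinearMap
  have hspec : ∀ a z, z ∈ spectrum ℂ a ↔ z ∈ (Algebra.lmul ℂ A a).charpoly.roots := by
    intro a z
    rw [Polynomial.mem_roots (LinearMap.charpoly_monic _).ne_zero,
      ← Module.End.hasEigenvalue_iff_isRoot_charpoly, Module.End.hasEigenvalue_iff_mem_spectrum,
      spectrum.mem_iff, spectrum.mem_iff, ← AlgHom.commutes (Algebra.lmul ℂ A), ← map_sub,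
      Algebra.lmul_isUnit_iff]
  have hτ : ∀ a, τ a = (Algebra.lmul ℂ A a).charpoly.roots.sum := fun a =>
    Module.End.trace_eq_sum_roots_charpoly_of_splits (IsAlgClosed.splits _)
  have hroot : ∀ a : A, ∀ z ∈ (Algebra.lmul ℂ A (star a * a)).charpoly.roots, 0 ≤ z := by
    intro a z hz
    rw [← hspec] at hz
    have hsa := IsSelfAdjoint.star_mul_self a
    have hre := hsa.mem_spectrum_eq_re hz
    rw [hre]
    rw [hre] at hz
    exact_mod_cast spectrum_star_mul_self_nonneg (b := a) _
      ((spectrum.algebraMap_mem_iff ℂ (r := z.re)).1 hz)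
  have hpos : ∀ a : A, 0 ≤ τ (star a * a) := fun a => by
    rw [hτ]; exact Multiset.sum_nonneg (hroot a)
  have hzero : ∀ a : A, τ (star a * a) = 0 → a = 0 := by
    intro a ha
    obtain ⟨z, hz, hzb⟩ := spectrum.exists_nnnorm_eq_spectralRadius (star a * a)
    rw [(IsSelfAdjoint.star_mul_self a).spectralRadius_eq_nnnorm] at hzb
    rw [hspec] at hz
    have h1 := Multiset.single_le_sum (hroot a) z hz
    rw [← hτ, ha] at h1
    have h2 : z = 0 := le_antisymm h1 (hroot a z hz)
    rw [h2, nnnorm_zero, ENNReal.coe_zero, eq_comm, ENNReal.coe_eq_zero, nnnorm_eq_zero] at hzb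
    exact CStarRing.star_mul_self_eq_zero_iff a |>.1 hzb
  have hone : τ 1 = Module.finrank ℂ A := by
    change LinearMap.trace ℂ A (Algebra.lmul ℂ A 1) = _
    rw [map_one, LinearMap.trace_one]
  have hn : (Module.finrank ℂ A : ℂ) ≠ 0 := by exact_mod_cast Module.finrank_pos.ne'
  refine ⟨⟨StrongDual.toWeakDual (LinearMap.toContinuousLinearMap
    ((Module.finrank ℂ A : ℂ)⁻¹ • τ)), ?_, fun a => ?_⟩, fun a ha => hzero a ?_⟩
  · change (Module.finrank ℂ A : ℂ)⁻¹ * τ 1 = 1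
    rw [hone, inv_mul_cancel₀ hn]
  · change 0 ≤ (Module.finrank ℂ A : ℂ)⁻¹ * τ (star a * a)
    refine mul_nonneg ?_ (hpos a)
    rw [← Complex.ofReal_natCast, ← Complex.ofReal_inv]
    exact_mod_cast inv_nonneg.2 (Nat.cast_nonneg (α := ℝ) _)
  · change (Module.finrank ℂ A : ℂ)⁻¹ * τ (star a * a) = 0 at ha
    exact (mul_eq_zero.1 ha).resolve_left (inv_ne_zero hn)

/-- A basis which is orthonormal for a given inner product. -/
theorem InnerProductSpace.Core.exists_orthonormal {V : Type*} [AddCommGroup V] [Module ℂ V]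
    [FiniteDimensional ℂ V] (c : InnerProductSpace.Core ℂ V) {N : Type*} [Fintype N] [DecidableEq N]
    (hN : Fintype.card N = Module.finrank ℂ V) :
    ∃ e : N → V, (∀ i j, c.inner (e i) (e j) = if i = j then 1 else 0) ∧
      ∀ x, ∑ i, c.inner (e i) x • e i = x := by
  let _ : NormedAddCommGroup V := c.toNormedAddCommGroup
  let _ : InnerProductSpace ℂ V := InnerProductSpace.ofCore c.toCore
  let b := (stdOrthonormalBasis ℂ V).reindex
    (Fintype.equivOfCardEq ((Fintype.card_fin _).trans hN.symm))
  exact ⟨b, fun i j => orthonormal_iff_ite.1 b.orthonormal i j, fun x => b.sum_repr' x⟩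

/-- The regular representation: a C*-algebra of dimension `n` embeds in the `n × n` matrices. -/
theorem exists_injective_starAlgHom_cstarMatrix [FiniteDimensional ℂ A] [Nontrivial A] {N : Type*}
    [Fintype N] [DecidableEq N] (hN : Fintype.card N = Module.finrank ℂ A) :
    ∃ π : A →⋆ₐ[ℂ] CStarMatrix N N ℂ, Function.Injective π := by
  obtain ⟨φ, hφ⟩ := exists_faithful_state (A := A)
  let c : InnerProductSpace.Core ℂ A :=
    { inner := fun a b => φ.1 (star a * b)
      conj_inner_symm := fun a b => by
        change star (φ.1 (star b * a)) = φ.1 (star a * b)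
        rw [← φ.map_star, star_mul, star_star]
      re_inner_nonneg := fun a => (Complex.le_def.1 (φ.2.2 a)).1
      add_left := fun a b x => by
        change φ.1 (star (a + b) * x) = φ.1 (star a * x) + φ.1 (star b * x)
        rw [star_add, add_mul, map_add]
      smul_left := fun a b z => by
        change φ.1 (star (z • a) * b) = star z * φ.1 (star a * b)
        rw [star_smul, smul_mul_assoc, map_smul, smul_eq_mul]
      definite := hφ }
  obtain ⟨e, he, hs⟩ := c.exists_orthonormal hN
  have hs' : ∀ x, ∑ i, φ.1 (star (e i) * x) • e i = x := hs
  -- Vanishing matrix coefficients force `a * e j = 0` for every basis vector; expanding the unit in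
  -- the basis gives `a = a * 1 = 0`.
  have hinj : ∀ a, (∀ i j, φ.1 (star (e i) * (a * e j)) = 0) → a = 0 := by
    intro a ha
    have h1 : ∀ j, a * e j = 0 := fun j => by rw [← hs' (a * e j)]; simp [ha]
    rw [← mul_one a, ← hs' 1, Finset.mul_sum]
    simp [h1]
  let π : A →⋆ₐ[ℂ] CStarMatrix N N ℂ :=
    { toFun := fun a => CStarMatrix.ofMatrix fun i j => φ.1 (star (e i) * (a * e j))
      map_one' := by
        ext i j
        change φ.1 (star (e i) * (1 * e j)) = _
        rw [one_mul, CStarMatrix.one_apply]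
        exact he i j
      map_zero' := by
        ext i j
        change φ.1 (star (e i) * (0 * e j)) = 0
        rw [zero_mul, mul_zero, map_zero]
      map_add' := fun a b => by
        ext i j
        change φ.1 (star (e i) * ((a + b) * e j)) =
          φ.1 (star (e i) * (a * e j)) + φ.1 (star (e i) * (b * e j))
        rw [add_mul, mul_add, map_add]
      map_mul' := fun a b => by
        ext i j
        rw [CStarMatrix.mul_apply]
        change φ.1 (star (e i) * ((a * b) * e j)) =
          ∑ k, φ.1 (star (e i) * (a * e k)) * φ.1 (star (e k) * (b * e j))
        conv_lhs => rw [mul_assoc, ← hs' (b * e j), Finset.mul_sum, Finset.mul_sum, map_sum]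
        refine Finset.sum_congr rfl fun k _ => ?_
        rw [mul_smul_comm, mul_smul_comm, map_smul, smul_eq_mul, mul_comm]
      commutes' := fun z => by
        ext i j
        change φ.1 (star (e i) * (algebraMap ℂ A z * e j)) = _
        rw [Algebra.algebraMap_eq_smul_one, Algebra.algebraMap_eq_smul_one, smul_mul_assoc, one_mul,
          mul_smul_comm, map_smul, CStarMatrix.smul_apply, CStarMatrix.one_apply]
        exact congrArg _ (he i j)
      map_star' := fun a => by
        ext i j
        change φ.1 (star (e i) * (star a * e j)) = star (φ.1 (star (e j) * (a * e i)))
        rw [← φ.map_star, star_mul, star_mul, star_star, mul_assoc] }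
  refine ⟨π, (injective_iff_map_eq_zero π).2 fun a ha => hinj a fun i j => ?_⟩
  exact congrFun (congrFun ha i) j

/-- Matrices over a smaller index set form a corner of the matrices over a larger one. -/
theorem exists_corner_embedding {N P : Type*} [Fintype N] [DecidableEq N] [Fintype P]
    [DecidableEq P] (f : N ↪ P) :
    ∃ j : CStarMatrix N N ℂ →⋆ₙₐ[ℂ] CStarMatrix P P ℂ, Function.Injective j := by
  -- `V` is the isometry of coordinate inclusion; the embedding is `x ↦ V x V*`, with left inverse
  -- `y ↦ V* y V`.
  let V : Matrix P N ℂ := Matrix.of fun p n => if p = f n then 1 else 0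
  have hV : V.conjTranspose * V = 1 := by
    ext i k
    simp [V, Matrix.mul_apply, Matrix.one_apply, Matrix.conjTranspose_apply, f.injective.eq_iff, eq_comm]
  let g : Matrix N N ℂ → Matrix P P ℂ := fun x => V * x * V.conjTranspose
  have hg : ∀ x, V.conjTranspose * g x * V = x := fun x => by
    simp only [g, Matrix.mul_assoc, hV, Matrix.mul_one]
    rw [← Matrix.mul_assoc, hV, Matrix.one_mul]
  let j : CStarMatrix N N ℂ →⋆ₙₐ[ℂ] CStarMatrix P P ℂ :=
    { toFun := fun x => CStarMatrix.ofMatrix (g (CStarMatrix.ofMatrix.symm x))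
      map_smul' := fun z x => by
        change g (z • CStarMatrix.ofMatrix.symm x) = z • g (CStarMatrix.ofMatrix.symm x)
        simp [g]
      map_zero' := by
        change g 0 = 0
        simp [g]
      map_add' := fun x y => by
        change g (CStarMatrix.ofMatrix.symm x + CStarMatrix.ofMatrix.symm y) =
          g (CStarMatrix.ofMatrix.symm x) + g (CStarMatrix.ofMatrix.symm y)
        simp [g, Matrix.mul_add, Matrix.add_mul]
      map_mul' := fun x y => by
        change g (CStarMatrix.ofMatrix.symm x * CStarMatrix.ofMatrix.symm y) =
          g (CStarMatrix.ofMatrix.symm x) * g (CStarMatrix.ofMatrix.symm y)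
        generalize CStarMatrix.ofMatrix.symm x = x
        generalize CStarMatrix.ofMatrix.symm y = y
        simp only [g]
        calc V * (x * y) * V.conjTranspose
            = V * (x * (1 * y)) * V.conjTranspose := by rw [Matrix.one_mul]
          _ = _ := by rw [← hV]; simp only [Matrix.mul_assoc]
      map_star' := fun x => by
        change g (CStarMatrix.ofMatrix.symm x).conjTranspose =
          (g (CStarMatrix.ofMatrix.symm x)).conjTranspose
        simp [g, Matrix.mul_assoc] }
  refine ⟨j, fun x y h => ?_⟩
  have h' : g (CStarMatrix.ofMatrix.symm x) = g (CStarMatrix.ofMatrix.symm y) := h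
  have := congrArg (fun z => V.conjTranspose * z * V) h'
  simp only [hg] at this
  exact this

end RegularRepresentation

/-! ### Lip-norms in finite dimension -/

section FiniteDimensional

variable {A : Type u} [CStarAlgebra A]

instance [FiniteDimensional ℂ A] : FiniteDimensional ℝ (selfAdjoint A) :=
  inferInstanceAs (FiniteDimensional ℝ (selfAdjoint.submodule ℝ A))

/-- Homogeneity rescales `a` into the Lip-ball. This makes evaluations Lipschitz for the
Monge-Kantorovich metric, so that its topology is finer than the weak* one. -/
theorem edist_le_mul_mongeKantorovich {L : selfAdjoint A → ℝ≥0∞}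
    (hsmul : ∀ (r : ℝ) (a), L (r • a) = ENNReal.ofReal |r| * L a) {a : selfAdjoint A} {r : ℝ≥0}
    (hr : r ≠ 0) (ha : L a ≤ r) (φ ψ : StateSpace A) :
    edist (φ.1 (a : A)) (ψ.1 (a : A)) ≤ r * mongeKantorovich L φ ψ := by
  have hr' : (r : ℝ≥0∞) ≠ 0 := by exact_mod_cast hr
  have h1 : L ((r : ℝ)⁻¹ • a) ≤ 1 := by
    rw [hsmul, abs_of_nonneg (by positivity), ENNReal.ofReal_inv_of_pos (by positivity),
      ENNReal.ofReal_coe_nnreal]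
    calc (r : ℝ≥0∞)⁻¹ * L a ≤ (r : ℝ≥0∞)⁻¹ * r := by gcongr
      _ = 1 := ENNReal.inv_mul_cancel hr' ENNReal.coe_ne_top
  have h2 : edist (φ.1 ((((r : ℝ)⁻¹ • a : selfAdjoint A)) : A))
      (ψ.1 ((((r : ℝ)⁻¹ • a : selfAdjoint A)) : A)) ≤ mongeKantorovich L φ ψ :=
    le_iSup₂ (f := fun (a : selfAdjoint A) (_ : L a ≤ 1) =>
        edist (φ.1 (a : A)) (ψ.1 (a : A))) _ h1
  have h3 : ((((r : ℝ)⁻¹ • a : selfAdjoint A)) : A) = ((r⁻¹ : ℝ≥0) : ℂ) • (a : A) := by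
    rw [selfAdjoint.val_smul, ← Complex.coe_smul]; simp
  rw [h3, map_smul, map_smul, edist_smul₀] at h2
  calc edist (φ.1 (a : A)) (ψ.1 (a : A))
      = r * ((r : ℝ≥0∞)⁻¹ * edist (φ.1 (a : A)) (ψ.1 (a : A))) := by
        rw [← mul_assoc, ENNReal.mul_inv_cancel hr' ENNReal.coe_ne_top, one_mul]
    _ ≤ _ := by
        gcongr
        refine le_trans (le_of_eq ?_) h2
        rw [ENNReal.smul_def, smul_eq_mul, ← ENNReal.coe_inv hr]
        congr 2
        ext; simp

/-- In finite dimension, if the Lip-ball is at bounded distance from the scalars, then the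
Monge-Kantorovich metric is dominated by finitely many evaluations. -/
theorem exists_mongeKantorovich_le_sum [FiniteDimensional ℂ A] {L : selfAdjoint A → ℝ≥0∞} {K : ℝ}
    (hK : ∀ a, L a ≤ 1 → ∃ t : ℝ, ‖a - t • (1 : selfAdjoint A)‖ ≤ K) :
    ∃ (n : ℕ) (b : Fin n → selfAdjoint A) (C : Fin n → ℝ≥0), ∀ φ ψ : StateSpace A,
      mongeKantorovich L φ ψ ≤ ∑ k, C k * edist (φ.1 (b k : A)) (ψ.1 (b k : A)) := by
  let b := Module.finBasis ℝ (selfAdjoint A)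
  let c : ∀ k, selfAdjoint A →L[ℝ] ℝ := fun k => LinearMap.toContinuousLinearMap (b.coord k)
  -- Two states agree on scalars, so `a` may be replaced by `a - t • 1`, of norm at most `K`. Its
  -- `k`-th coordinate is then at most `‖c k‖ * K`.
  refine ⟨_, b, fun k => ‖c k‖₊ * K.toNNReal, fun φ ψ => iSup₂_le fun a ha => ?_⟩
  obtain ⟨t, ht⟩ := hK a ha
  obtain ⟨f, hf1, -, hf⟩ := φ.exists_real
  obtain ⟨g, hg1, -, hg⟩ := ψ.exists_real
  set x := a - t • (1 : selfAdjoint A) with hx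
  have h1 : f a - g a = (f - g) x := by
    simp [hx, hf1, hg1]
  have h2 : (f - g) x = ∑ k, c k x * (f - g) (b k) := by
    conv_lhs => rw [← b.sum_repr x]
    rw [map_sum]
    simp only [map_smul, smul_eq_mul]
    rfl
  have hedist : ∀ y : selfAdjoint A, edist (φ.1 (y : A)) (ψ.1 (y : A)) =
      (‖(f - g) y‖₊ : ℝ≥0∞) := fun y => by
    rw [hf, hg, edist_eq_enorm_sub, ← Complex.ofReal_sub]
    simp only [enorm, LinearMap.sub_apply]
    congr 1
    exact Complex.nnnorm_real _
  have h3 : (f - g) a = (f - g) x := h1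
  simp only [hedist]
  rw [h3, h2]
  norm_cast
  refine (nnnorm_sum_le _ _).trans (Finset.sum_le_sum fun k _ => ?_)
  rw [nnnorm_mul]
  gcongr
  refine (ContinuousLinearMap.le_opNNNorm _ _).trans ?_
  gcongr
  exact NNReal.coe_le_coe.1 (by simpa using Or.inl ht)

/-- In finite dimension, a seminorm vanishing exactly on the scalars and whose ball is at bounded
distance from the scalars is a Lip-norm. -/
theorem isQuasiLeibnizLipNorm_of_finiteDimensional [FiniteDimensional ℂ A]
    {L : selfAdjoint A → ℝ≥0∞} {K : ℝ}
    (add_le : ∀ a b, L (a + b) ≤ L a + L b)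
    (smul : ∀ (r : ℝ) (a), L (r • a) = ENNReal.ofReal |r| * L a)
    (lt_top : ∀ a, L a < ∞)
    (eq_zero_iff : ∀ a, L a = 0 ↔ ∃ t : ℝ, a = t • (1 : selfAdjoint A))
    (isClosed_ball : IsClosed {a | L a ≤ 1})
    (hK : ∀ a, L a ≤ 1 → ∃ t : ℝ, ‖a - t • (1 : selfAdjoint A)‖ ≤ K)
    (jordan_le : ∀ a b,
      L (jordanProd a b) ≤ F (‖(a : A)‖₊, ‖(b : A)‖₊, (L a).toNNReal, (L b).toNNReal))
    (lie_le : ∀ a b,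
      L (lieProd a b) ≤ F (‖(a : A)‖₊, ‖(b : A)‖₊, (L a).toNNReal, (L b).toNNReal)) :
    IsQuasiLeibnizLipNorm F L := by
  obtain ⟨n, b, C, hC⟩ := exists_mongeKantorovich_le_sum hK
  refine ⟨add_le, smul, ?_, eq_zero_iff, isClosed_ball, fun φ ψ => ?_, le_antisymm ?_ ?_,
    fun a b _ _ => jordan_le a b, fun a b _ _ => lie_le a b⟩
  · simp [lt_top]
  · exact (hC φ ψ).trans_lt (ENNReal.sum_lt_top.2 fun k _ =>
      ENNReal.mul_lt_top ENNReal.coe_lt_top (edist_lt_top _ _))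
  · have hsa : ∀ a : selfAdjoint A,
        @Continuous _ _ (mongeKantorovichSpace L).toUniformSpace.toTopologicalSpace _
          (fun φ : StateSpace A => φ.1 (a : A)) := fun a => by
      -- The `+ 1` keeps the Lipschitz constant nonzero when `L a = 0`.
      exact @LipschitzWith.continuous _ _ (mongeKantorovichSpace L) _ ((L a).toNNReal + 1) _
        fun φ ψ =>
        edist_le_mul_mongeKantorovich smul (by positivity) (by
          rw [ENNReal.coe_add, ENNReal.coe_toNNReal (lt_top a).ne]
          exact le_self_add) φ ψ
    refine continuous_id_iff_le.1 ?_
    let _ : TopologicalSpace (StateSpace A) :=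
      (mongeKantorovichSpace L).toUniformSpace.toTopologicalSpace
    refine continuous_induced_rng.2 (WeakDual.continuous_of_continuous_eval fun a => ?_)
    have : (fun φ : StateSpace A => φ.1 a) =
        fun φ => φ.1 (ℜ a : A) + Complex.I • φ.1 (ℑ a : A) := by
      ext φ
      conv_lhs => rw [← realPart_add_I_smul_imaginaryPart a]
      rw [map_add, map_smul]
    change Continuous (fun φ : StateSpace A => φ.1 a)
    rw [this]
    exact (hsa _).add (continuous_const.mul (hsa _))
  · refine continuous_id_iff_le.1 ((@continuous_iff_continuousAt _ _ _
      (mongeKantorovichSpace L).toUniformSpace.toTopologicalSpace _).2 fun φ => ?_)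
    have hcont : Continuous (fun ψ : StateSpace A =>
        ∑ k, (C k : ℝ≥0∞) * edist (ψ.1 (b k : A)) (φ.1 (b k : A))) := by
      refine continuous_finsetSum _ fun k _ => ?_
      refine (ENNReal.continuous_const_mul ENNReal.coe_ne_top).comp ?_
      exact ((WeakDual.eval_continuous (b k : A)).comp continuous_subtype_val).edist
        continuous_const
    have h0 := hcont.tendsto φ
    simp only [edist_self, mul_zero, Finset.sum_const_zero] at h0
    refine (@tendsto_iff_edist_tendsto_0 _ _ (mongeKantorovichSpace L) _ _ _).2 ?_
    exact tendsto_of_tendsto_of_tendsto_of_le_of_le tendsto_const_nhds h0 (fun _ => zero_le)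
      (fun ψ => hC ψ φ)

/-- The domain is a dense subspace, and subspaces of a finite-dimensional space are closed. -/
theorem IsQuasiLeibnizLipNorm.lt_top [FiniteDimensional ℂ A] {L : selfAdjoint A → ℝ≥0∞}
    (hL : IsQuasiLeibnizLipNorm F L) (a : selfAdjoint A) : L a < ∞ := by
  let V : Submodule ℝ (selfAdjoint A) :=
    { carrier := {a | L a < ∞}
      add_mem' := fun ha hb => (hL.add_le _ _).trans_lt (ENNReal.add_lt_top.2 ⟨ha, hb⟩)
      zero_mem' := by
        have : L 0 = 0 := (hL.eq_zero_iff 0).2 ⟨0, by simp⟩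
        simp [this]
      smul_mem' := fun r a ha => by
        change L (r • a) < ∞
        rw [hL.smul]
        exact ENNReal.mul_lt_top ENNReal.ofReal_lt_top ha }
  have hV : (V : Set (selfAdjoint A)) = Set.univ := by
    rw [← (Submodule.closed_of_finiteDimensional V).closure_eq]
    exact hL.dense_dom.closure_eq
  exact (hV ▸ Set.mem_univ a : a ∈ (V : Set (selfAdjoint A)))

/-- Take `t = φ a` for any state `φ`, and let a state `ψ` norm `a - t • 1`: the norm is then `|ψ a -
φ a|`, which the diameter controls. -/
theorem QQCMS.norm_sub_le (X : QQCMS.{u} F) {K : ℝ} (hX : X.stateDiam ≤ ENNReal.ofReal K)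
    (hK : 0 ≤ K) {a : selfAdjoint X.Alg} (ha : X.L a ≤ 1) :
    ∃ t : ℝ, ‖a - t • (1 : selfAdjoint X.Alg)‖ ≤ K := by
  obtain ⟨φ, -⟩ := exists_state_norm_eq a
  obtain ⟨f, -, -, hf⟩ := φ.exists_real
  refine ⟨f a, ?_⟩
  obtain ⟨ψ, hψ⟩ := exists_state_norm_eq (a - f a • (1 : selfAdjoint X.Alg))
  obtain ⟨g, hg1, -, hg⟩ := ψ.exists_real
  rw [← hψ]
  have h1 : ψ.1 ((a - f a • (1 : selfAdjoint X.Alg) : selfAdjoint X.Alg) : X.Alg) =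
      ψ.1 (a : X.Alg) - φ.1 (a : X.Alg) := by
    rw [hg, hg, hf, map_sub, map_smul, hg1]; simp
  rw [h1, ← dist_eq_norm]
  have h2 : edist (ψ.1 (a : X.Alg)) (φ.1 (a : X.Alg)) ≤ ENNReal.ofReal K :=
    (le_iSup₂ (f := fun (a : selfAdjoint X.Alg) (_ : X.L a ≤ 1) =>
      edist (ψ.1 (a : X.Alg)) (φ.1 (a : X.Alg))) a ha).trans
      ((le_iSup₂ (f := fun φ ψ => mongeKantorovich X.L φ ψ) ψ φ).trans hX)
  rwa [edist_dist, ENNReal.ofReal_le_ofReal_iff hK] at h2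

end FiniteDimensional

/-! ### Morphisms on self-adjoint parts -/

section SelfAdjointMap

variable {A B : Type*} [CStarAlgebra A] [CStarAlgebra B]

/-- The map of self-adjoint parts induced by a *-morphism. -/
noncomputable def StarAlgHom.selfAdjointMap (π : A →⋆ₐ[ℂ] B) : selfAdjoint A →ₗ[ℝ] selfAdjoint B where
  toFun a := ⟨π a, a.2.map π⟩
  map_add' a b := Subtype.ext (by simp)
  map_smul' r a := Subtype.ext (by
    change π ((r • a : selfAdjoint A) : A) = r • π (a : A)
    rw [selfAdjoint.val_smul, ← Complex.coe_smul, map_smul, Complex.coe_smul])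

@[simp]
theorem StarAlgHom.coe_selfAdjointMap (π : A →⋆ₐ[ℂ] B) (a : selfAdjoint A) :
    (π.selfAdjointMap a : B) = π a := rfl

theorem StarAlgHom.selfAdjointMap_one (π : A →⋆ₐ[ℂ] B) : π.selfAdjointMap 1 = 1 :=
  Subtype.ext (by simp)

theorem StarAlgHom.continuous_selfAdjointMap (π : A →⋆ₐ[ℂ] B) : Continuous π.selfAdjointMap :=
  ((map_continuous π).comp continuous_subtype_val).subtype_mk _

theorem norm_mul_sub_mul_le {p p' q q' : A} {x y : ℝ} (hp : ‖p‖ ≤ x) (hq' : ‖q'‖ ≤ y) :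
    ‖p * p' - q * q'‖ ≤ x * ‖p' - q'‖ + y * ‖p - q‖ := by
  have : p * p' - q * q' = p * (p' - q') + (p - q) * q' := by noncomm_ring
  rw [this]
  refine (norm_add_le _ _).trans (add_le_add ((norm_mul_le _ _).trans (by gcongr))
    ((norm_mul_le _ _).trans ?_))
  rw [mul_comm]
  gcongr

end SelfAdjointMap

/-! ### Jordan and Lie products: naturality and estimates -/

section Products

variable {A B : Type u} [CStarAlgebra A] [CStarAlgebra B]

theorem StarAlgHom.selfAdjointMap_jordanProd (π : A →⋆ₐ[ℂ] B) (a b : selfAdjoint A) :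
    π.selfAdjointMap (jordanProd a b) = jordanProd (π.selfAdjointMap a) (π.selfAdjointMap b) :=
  Subtype.ext (by
    change π ((1 / 2 : ℂ) • ((a : A) * b + b * a)) = (1 / 2 : ℂ) • (π a * π b + π b * π a)
    rw [map_smul, map_add, map_mul, map_mul])

theorem StarAlgHom.selfAdjointMap_lieProd (π : A →⋆ₐ[ℂ] B) (a b : selfAdjoint A) :
    π.selfAdjointMap (lieProd a b) = lieProd (π.selfAdjointMap a) (π.selfAdjointMap b) :=
  Subtype.ext (by
    change π ((1 / (2 * Complex.I) : ℂ) • ((a : A) * b - b * a)) =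
      (1 / (2 * Complex.I) : ℂ) • (π a * π b - π b * π a)
    rw [map_smul, map_sub, map_mul, map_mul])

/-- The right-hand side has the shape `x l_y + y l_x` of the lower bound for a permissible function,
which is what makes the bridge term quasi-Leibniz. The factor one half averages the estimates for
the two orders of multiplication. -/
theorem norm_jordanProd_sub_le {p p' q q' : selfAdjoint A} {x y : ℝ} (hp : ‖p‖ ≤ x) (hq : ‖q‖ ≤ x)
    (hp' : ‖p'‖ ≤ y) (hq' : ‖q'‖ ≤ y) :
    ‖jordanProd p p' - jordanProd q q'‖ ≤ x * ‖p' - q'‖ + y * ‖p - q‖ := by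
  have h1 := norm_mul_sub_mul_le (p := (p : A)) (p' := (p' : A)) (q := (q : A)) (q' := (q' : A)) hp hq'
  have h2 := norm_mul_sub_mul_le (p := (p' : A)) (p' := (p : A)) (q := (q' : A)) (q' := (q : A)) hp' hq
  have : ((jordanProd p p' - jordanProd q q' : selfAdjoint A) : A) =
      (1 / 2 : ℂ) • (((p : A) * p' - q * q') + ((p' : A) * p - q' * q)) := by
    change (1 / 2 : ℂ) • _ - (1 / 2 : ℂ) • _ = _
    rw [← smul_sub]
    congr 1
    abel
  change ‖((jordanProd p p' - jordanProd q q' : selfAdjoint A) : A)‖ ≤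
    x * ‖(p' : A) - q'‖ + y * ‖(p : A) - q‖
  rw [this, norm_smul, norm_div, norm_one, Complex.norm_ofNat]
  have := norm_add_le ((p : A) * p' - q * q') ((p' : A) * p - q' * q)
  linarith

theorem norm_lieProd_sub_le {p p' q q' : selfAdjoint A} {x y : ℝ} (hp : ‖p‖ ≤ x) (hq : ‖q‖ ≤ x)
    (hp' : ‖p'‖ ≤ y) (hq' : ‖q'‖ ≤ y) :
    ‖lieProd p p' - lieProd q q'‖ ≤ x * ‖p' - q'‖ + y * ‖p - q‖ := by
  have h1 := norm_mul_sub_mul_le (p := (p : A)) (p' := (p' : A)) (q := (q : A)) (q' := (q' : A)) hp hq'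
  have h2 := norm_mul_sub_mul_le (p := (p' : A)) (p' := (p : A)) (q := (q' : A)) (q' := (q : A)) hp' hq
  have : ((lieProd p p' - lieProd q q' : selfAdjoint A) : A) =
      (1 / (2 * Complex.I) : ℂ) • (((p : A) * p' - q * q') - ((p' : A) * p - q' * q)) := by
    change (1 / (2 * Complex.I) : ℂ) • _ - (1 / (2 * Complex.I) : ℂ) • _ = _
    rw [← smul_sub]
    congr 1
    abel
  change ‖((lieProd p p' - lieProd q q' : selfAdjoint A) : A)‖ ≤
    x * ‖(p' : A) - q'‖ + y * ‖(p : A) - q‖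
  rw [this, norm_smul, norm_div, norm_one, norm_mul, Complex.norm_ofNat, Complex.norm_I]
  have := norm_sub_le ((p : A) * p' - q * q') ((p' : A) * p - q' * q)
  linarith

end Products

/-! ### Tunnels from a common ambient algebra -/

section Bridge

variable {X Y : QQCMS.{u} F} {M : Type u} [CStarAlgebra M]

theorem QQCMS.L_smul_one (X : QQCMS.{u} F) (t : ℝ) : X.L (t • 1) = 0 :=
  (X.isLipNorm.eq_zero_iff _).2 ⟨t, rfl⟩

/-- The distance in `M` of the two components of an element of `X × Y`. -/
noncomputable def bridgeSeminorm (π : X.Alg →⋆ₐ[ℂ] M) (ρ : Y.Alg →⋆ₐ[ℂ] M)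
    (d : selfAdjoint (X.Alg × Y.Alg)) : ℝ≥0 :=
  ‖(π.comp (StarAlgHom.fst ℂ _ _)).selfAdjointMap d -
    (ρ.comp (StarAlgHom.snd ℂ _ _)).selfAdjointMap d‖₊

/-- The Lip-norm on `X × Y` defined by a bridge. -/
noncomputable def bridgeLipNorm (π : X.Alg →⋆ₐ[ℂ] M) (ρ : Y.Alg →⋆ₐ[ℂ] M) (e : ℝ≥0)
    (d : selfAdjoint (X.Alg × Y.Alg)) : ℝ≥0∞ :=
  max (max (X.L ((StarAlgHom.fst ℂ _ _).selfAdjointMap d))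
    (Y.L ((StarAlgHom.snd ℂ _ _).selfAdjointMap d))) (e * bridgeSeminorm π ρ d : ℝ≥0)

variable {π : X.Alg →⋆ₐ[ℂ] M} {ρ : Y.Alg →⋆ₐ[ℂ] M} {e : ℝ≥0}

theorem bridgeSeminorm_add_le (c d : selfAdjoint (X.Alg × Y.Alg)) :
    bridgeSeminorm π ρ (c + d) ≤ bridgeSeminorm π ρ c + bridgeSeminorm π ρ d := by
  unfold bridgeSeminorm
  rw [map_add, map_add, add_sub_add_comm]
  exact nnnorm_add_le _ _

theorem bridgeSeminorm_smul (r : ℝ) (d : selfAdjoint (X.Alg × Y.Alg)) :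
    bridgeSeminorm π ρ (r • d) = ‖r‖₊ * bridgeSeminorm π ρ d := by
  unfold bridgeSeminorm
  rw [map_smul, map_smul, ← smul_sub, nnnorm_smul]

/-- The bridge seminorm satisfies the Leibniz inequality for every product which does so up to the
distance in `M`. -/
theorem bridgeLipNorm_prod_le [FiniteDimensional ℂ X.Alg] [FiniteDimensional ℂ Y.Alg]
    (hF : Permissible F)
    {P : selfAdjoint (X.Alg × Y.Alg) → selfAdjoint (X.Alg × Y.Alg) → selfAdjoint (X.Alg × Y.Alg)}
    {PX : selfAdjoint X.Alg → selfAdjoint X.Alg → selfAdjoint X.Alg}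
    {PY : selfAdjoint Y.Alg → selfAdjoint Y.Alg → selfAdjoint Y.Alg}
    {PM : selfAdjoint M → selfAdjoint M → selfAdjoint M}
    (hPX : ∀ c d, (StarAlgHom.fst ℂ _ _).selfAdjointMap (P c d) =
      PX ((StarAlgHom.fst ℂ _ _).selfAdjointMap c) ((StarAlgHom.fst ℂ _ _).selfAdjointMap d))
    (hPY : ∀ c d, (StarAlgHom.snd ℂ _ _).selfAdjointMap (P c d) =
      PY ((StarAlgHom.snd ℂ _ _).selfAdjointMap c) ((StarAlgHom.snd ℂ _ _).selfAdjointMap d))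
    (hPπ : ∀ c d, (π.comp (StarAlgHom.fst ℂ _ _)).selfAdjointMap (P c d) =
      PM ((π.comp (StarAlgHom.fst ℂ _ _)).selfAdjointMap c)
        ((π.comp (StarAlgHom.fst ℂ _ _)).selfAdjointMap d))
    (hPρ : ∀ c d, (ρ.comp (StarAlgHom.snd ℂ _ _)).selfAdjointMap (P c d) =
      PM ((ρ.comp (StarAlgHom.snd ℂ _ _)).selfAdjointMap c)
        ((ρ.comp (StarAlgHom.snd ℂ _ _)).selfAdjointMap d))
    (hX : ∀ a b, X.L a < ∞ → X.L b < ∞ →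
      X.L (PX a b) ≤ F (‖(a : X.Alg)‖₊, ‖(b : X.Alg)‖₊, (X.L a).toNNReal, (X.L b).toNNReal))
    (hY : ∀ a b, Y.L a < ∞ → Y.L b < ∞ →
      Y.L (PY a b) ≤ F (‖(a : Y.Alg)‖₊, ‖(b : Y.Alg)‖₊, (Y.L a).toNNReal, (Y.L b).toNNReal))
    (hM : ∀ {p p' q q' : selfAdjoint M} {x y : ℝ}, ‖p‖ ≤ x → ‖q‖ ≤ x → ‖p'‖ ≤ y → ‖q'‖ ≤ y →
      ‖PM p p' - PM q q'‖ ≤ x * ‖p' - q'‖ + y * ‖p - q‖)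
    (c d : selfAdjoint (X.Alg × Y.Alg)) :
    bridgeLipNorm π ρ e (P c d) ≤ F (‖(c : X.Alg × Y.Alg)‖₊, ‖(d : X.Alg × Y.Alg)‖₊,
      (bridgeLipNorm π ρ e c).toNNReal, (bridgeLipNorm π ρ e d).toNNReal) := by
  have hfin : ∀ c, bridgeLipNorm π ρ e c ≠ ∞ := fun c =>
    (max_lt (max_lt (X.isLipNorm.lt_top _) (Y.isLipNorm.lt_top _)) ENNReal.coe_lt_top).ne
  have hLX : ∀ c, (X.L ((StarAlgHom.fst ℂ _ _).selfAdjointMap c)).toNNReal ≤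
      (bridgeLipNorm π ρ e c).toNNReal := fun c => ENNReal.toNNReal_mono (hfin c)
    ((le_max_left _ _).trans (le_max_left _ _))
  have hLY : ∀ c, (Y.L ((StarAlgHom.snd ℂ _ _).selfAdjointMap c)).toNNReal ≤
      (bridgeLipNorm π ρ e c).toNNReal := fun c => ENNReal.toNNReal_mono (hfin c)
    ((le_max_right _ _).trans (le_max_left _ _))
  have hLN : ∀ c, e * bridgeSeminorm π ρ c ≤ (bridgeLipNorm π ρ e c).toNNReal := fun c =>
    ENNReal.toNNReal_mono (hfin c) (le_max_right _ _)
  have hnX : ∀ c : selfAdjoint (X.Alg × Y.Alg),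
      ‖((StarAlgHom.fst ℂ _ _).selfAdjointMap c : X.Alg)‖₊ ≤ ‖(c : X.Alg × Y.Alg)‖₊ :=
    fun c => norm_fst_le (c : X.Alg × Y.Alg)
  have hnY : ∀ c : selfAdjoint (X.Alg × Y.Alg),
      ‖((StarAlgHom.snd ℂ _ _).selfAdjointMap c : Y.Alg)‖₊ ≤ ‖(c : X.Alg × Y.Alg)‖₊ :=
    fun c => norm_snd_le (c : X.Alg × Y.Alg)
  refine max_le (max_le ?_ ?_) (ENNReal.coe_le_coe.2 ?_)
  · rw [hPX]
    exact (hX _ _ (X.isLipNorm.lt_top _) (X.isLipNorm.lt_top _)).trans (ENNReal.coe_le_coe.2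
      (hF.monotone ⟨hnX c, hnX d, hLX c, hLX d⟩))
  · rw [hPY]
    exact (hY _ _ (Y.isLipNorm.lt_top _) (Y.isLipNorm.lt_top _)).trans (ENNReal.coe_le_coe.2
      (hF.monotone ⟨hnY c, hnY d, hLY c, hLY d⟩))
  · have h1 : ∀ c, ‖(π.comp (StarAlgHom.fst ℂ X.Alg Y.Alg)).selfAdjointMap c‖ ≤ ‖(c : X.Alg × Y.Alg)‖ :=
      fun c => NonUnitalStarAlgHom.norm_apply_le (π.comp (StarAlgHom.fst ℂ X.Alg Y.Alg))
        (c : X.Alg × Y.Alg)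
    have h2 : ∀ c, ‖(ρ.comp (StarAlgHom.snd ℂ X.Alg Y.Alg)).selfAdjointMap c‖ ≤ ‖(c : X.Alg × Y.Alg)‖ :=
      fun c => NonUnitalStarAlgHom.norm_apply_le (ρ.comp (StarAlgHom.snd ℂ X.Alg Y.Alg))
        (c : X.Alg × Y.Alg)
    have h3 : bridgeSeminorm π ρ (P c d) ≤ ‖(c : X.Alg × Y.Alg)‖₊ * bridgeSeminorm π ρ d +
        ‖(d : X.Alg × Y.Alg)‖₊ * bridgeSeminorm π ρ c := by
      unfold bridgeSeminorm
      rw [hPπ, hPρ]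
      exact hM (h1 c) (h2 c) (h1 d) (h2 d)
    calc e * bridgeSeminorm π ρ (P c d)
        ≤ e * (‖(c : X.Alg × Y.Alg)‖₊ * bridgeSeminorm π ρ d +
          ‖(d : X.Alg × Y.Alg)‖₊ * bridgeSeminorm π ρ c) := by gcongr
      _ = ‖(c : X.Alg × Y.Alg)‖₊ * (e * bridgeSeminorm π ρ d) +
          ‖(d : X.Alg × Y.Alg)‖₊ * (e * bridgeSeminorm π ρ c) := by ring
      _ ≤ _ := (hF.le_apply _ _ _ _).trans (hF.monotone (Prod.mk_le_mk.2 ⟨le_rfl,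
          Prod.mk_le_mk.2 ⟨le_rfl, Prod.mk_le_mk.2 ⟨hLN c, hLN d⟩⟩⟩))

/-- The bridge term ties the two components together: since the unit of `M` has norm one, scalars
close to the two components are close to each other. Hence the kernel is the single line of common
scalars, and the ball is bounded modulo that line. -/
theorem isQuasiLeibnizLipNorm_bridgeLipNorm [FiniteDimensional ℂ X.Alg] [FiniteDimensional ℂ Y.Alg]
    [Nontrivial M] (hF : Permissible F) {K : ℝ} (hK : 0 ≤ K) (hX : X.stateDiam ≤ ENNReal.ofReal K)
    (hY : Y.stateDiam ≤ ENNReal.ofReal K) (he : e ≠ 0) :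
    IsQuasiLeibnizLipNorm F (bridgeLipNorm π ρ e) := by
  have hdist : ∀ (d : selfAdjoint (X.Alg × Y.Alg)) (s t : ℝ),
      |s - t| ≤ ‖(StarAlgHom.fst ℂ _ _).selfAdjointMap d - s • (1 : selfAdjoint X.Alg)‖ +
        bridgeSeminorm π ρ d +
        ‖(StarAlgHom.snd ℂ _ _).selfAdjointMap d - t • (1 : selfAdjoint Y.Alg)‖ := by
    intro d s t
    set a := (StarAlgHom.fst ℂ X.Alg Y.Alg).selfAdjointMap d
    set b := (StarAlgHom.snd ℂ X.Alg Y.Alg).selfAdjointMap d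
    have h0 : (s - t) • (1 : selfAdjoint M) =
        -(π.selfAdjointMap (a - s • 1)) + (π.selfAdjointMap a - ρ.selfAdjointMap b) +
          ρ.selfAdjointMap (b - t • 1) := by
      rw [map_sub, map_sub, map_smul, map_smul, π.selfAdjointMap_one, ρ.selfAdjointMap_one, sub_smul]
      abel
    have h1 : |s - t| = ‖(s - t) • (1 : selfAdjoint M)‖ := by
      rw [norm_smul, Real.norm_eq_abs]
      change _ = _ * ‖(1 : M)‖
      rw [CStarRing.norm_one, mul_one]
    rw [h1, h0]
    refine (norm_add_le _ _).trans (add_le_add ((norm_add_le _ _).trans (add_le_add ?_ le_rfl)) ?_)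
    · rw [norm_neg]
      exact NonUnitalStarAlgHom.norm_apply_le π _
    · exact NonUnitalStarAlgHom.norm_apply_le ρ _
  have hext : ∀ (d : selfAdjoint (X.Alg × Y.Alg)) (s : ℝ),
      (StarAlgHom.fst ℂ _ _).selfAdjointMap d = s • (1 : selfAdjoint X.Alg) →
      (StarAlgHom.snd ℂ _ _).selfAdjointMap d = s • (1 : selfAdjoint Y.Alg) →
      d = s • (1 : selfAdjoint (X.Alg × Y.Alg)) := fun d s h1 h2 =>
    Subtype.ext (Prod.ext (congrArg Subtype.val h1) (congrArg Subtype.val h2))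
  -- The scalar `s` of the first component serves for both. The second is within `K` of its own
  -- scalar `t`, and `|s - t| ≤ K + e⁻¹ + K`.
  refine isQuasiLeibnizLipNorm_of_finiteDimensional (K := K + (K + (e : ℝ)⁻¹ + K)) ?_ ?_ ?_ ?_ ?_ ?_ ?_ ?_
  · intro c d
    refine max_le (max_le ?_ ?_) ?_
    · rw [map_add]
      exact (X.isLipNorm.add_le _ _).trans
        (add_le_add ((le_max_left _ _).trans (le_max_left _ _))
          ((le_max_left _ _).trans (le_max_left _ _)))
    · rw [map_add]
      exact (Y.isLipNorm.add_le _ _).trans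
        (add_le_add ((le_max_right _ _).trans (le_max_left _ _))
          ((le_max_right _ _).trans (le_max_left _ _)))
    · refine le_trans ?_ (add_le_add (le_max_right _ _) (le_max_right _ _))
      rw [← ENNReal.coe_add, ENNReal.coe_le_coe, ← mul_add]
      gcongr
      exact bridgeSeminorm_add_le c d
  · intro r d
    have h : ENNReal.ofReal |r| = (‖r‖₊ : ℝ≥0∞) := by
      rw [← Real.norm_eq_abs, ofReal_norm]; rfl
    unfold bridgeLipNorm
    rw [map_smul, map_smul, X.isLipNorm.smul, Y.isLipNorm.smul, bridgeSeminorm_smul, mul_max, mul_max,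
      h, ← ENNReal.coe_mul]
    congr 2
    ring
  · exact fun d => max_lt (max_lt (X.isLipNorm.lt_top _) (Y.isLipNorm.lt_top _)) ENNReal.coe_lt_top
  · intro d
    constructor
    · intro h
      have h1 := nonpos_iff_eq_zero.1 (((le_max_left _ _).trans (le_max_left _ _)).trans h.le)
      have h2 := nonpos_iff_eq_zero.1 (((le_max_right _ _).trans (le_max_left _ _)).trans h.le)
      have h3 := nonpos_iff_eq_zero.1 ((le_max_right _ _).trans h.le)
      rw [ENNReal.coe_eq_zero, mul_eq_zero, or_iff_right he] at h3
      obtain ⟨s, hs⟩ := (X.isLipNorm.eq_zero_iff _).1 h1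
      obtain ⟨t, ht⟩ := (Y.isLipNorm.eq_zero_iff _).1 h2
      have h4 := hdist d s t
      rw [hs, ht, h3, sub_self, sub_self, norm_zero, norm_zero, NNReal.coe_zero, add_zero, add_zero,
        abs_nonpos_iff, sub_eq_zero] at h4
      exact ⟨s, hext d s hs (h4 ▸ ht)⟩
    · rintro ⟨t, rfl⟩
      have h3 : bridgeSeminorm π ρ (t • 1) = 0 := by
        unfold bridgeSeminorm
        rw [map_smul, map_smul, StarAlgHom.selfAdjointMap_one, StarAlgHom.selfAdjointMap_one,
          sub_self, nnnorm_zero]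
      unfold bridgeLipNorm
      rw [map_smul, map_smul, StarAlgHom.selfAdjointMap_one, StarAlgHom.selfAdjointMap_one,
        X.L_smul_one, Y.L_smul_one, h3]
      simp
  · have hc : Continuous (bridgeSeminorm π ρ) :=
      ((StarAlgHom.continuous_selfAdjointMap _).sub (StarAlgHom.continuous_selfAdjointMap _)).nnnorm
    have : {d | bridgeLipNorm π ρ e d ≤ 1} =
        ((StarAlgHom.fst ℂ _ _).selfAdjointMap ⁻¹' {a | X.L a ≤ 1} ∩
          (StarAlgHom.snd ℂ _ _).selfAdjointMap ⁻¹' {b | Y.L b ≤ 1}) ∩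
          {d | e * bridgeSeminorm π ρ d ≤ 1} := by
      ext d
      simp only [bridgeLipNorm, Set.mem_ofPred_eq, max_le_iff, Set.mem_inter_iff, Set.mem_preimage,
        ENNReal.coe_le_one_iff]
    rw [this]
    exact ((X.isLipNorm.isClosed_ball.preimage (StarAlgHom.continuous_selfAdjointMap _)).inter
      (Y.isLipNorm.isClosed_ball.preimage (StarAlgHom.continuous_selfAdjointMap _))).inter
      (isClosed_le (continuous_const.mul hc) continuous_const)
  · intro d hd
    simp only [bridgeLipNorm, max_le_iff, ENNReal.coe_le_one_iff] at hd
    obtain ⟨⟨h1, h2⟩, h3⟩ := hd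
    obtain ⟨s, hs⟩ := X.norm_sub_le hX hK h1
    obtain ⟨t, ht⟩ := Y.norm_sub_le hY hK h2
    have h4 := hdist d s t
    have h5 : bridgeSeminorm π ρ d ≤ e⁻¹ := by
      simpa using (le_inv_mul_iff₀ (pos_iff_ne_zero.2 he)).2 h3
    have h5' : (bridgeSeminorm π ρ d : ℝ) ≤ (e : ℝ)⁻¹ := by exact_mod_cast h5
    have he' : 0 ≤ (e : ℝ)⁻¹ := by positivity
    refine ⟨s, ?_⟩
    change max ‖_‖ ‖_‖ ≤ _
    refine max_le ?_ ?_
    · have h6 : ‖(d : X.Alg × Y.Alg).1 - s • (1 : X.Alg)‖ ≤ K := hs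
      exact h6.trans (by linarith)
    · have h6 : ‖(d : X.Alg × Y.Alg).2 - t • (1 : Y.Alg)‖ ≤ K := ht
      have h7 : (d : X.Alg × Y.Alg).2 - s • (1 : Y.Alg) =
          ((d : X.Alg × Y.Alg).2 - t • (1 : Y.Alg)) - (s - t) • (1 : Y.Alg) := by
        rw [sub_smul]; abel
      have h8 : ‖(s - t) • (1 : Y.Alg)‖ = |s - t| := by
        rw [norm_smul, CStarRing.norm_one, mul_one, Real.norm_eq_abs]
      change ‖(d : X.Alg × Y.Alg).2 - s • (1 : Y.Alg)‖ ≤ _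
      rw [h7]
      refine (norm_sub_le _ _).trans ?_
      rw [h8]
      linarith
  · exact bridgeLipNorm_prod_le hF (fun _ _ => StarAlgHom.selfAdjointMap_jordanProd _ _ _)
      (fun _ _ => StarAlgHom.selfAdjointMap_jordanProd _ _ _)
      (fun _ _ => StarAlgHom.selfAdjointMap_jordanProd _ _ _)
      (fun _ _ => StarAlgHom.selfAdjointMap_jordanProd _ _ _)
      X.isLipNorm.jordan_le Y.isLipNorm.jordan_le norm_jordanProd_sub_le
  · exact bridgeLipNorm_prod_le hF (fun _ _ => StarAlgHom.selfAdjointMap_lieProd _ _ _)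
      (fun _ _ => StarAlgHom.selfAdjointMap_lieProd _ _ _)
      (fun _ _ => StarAlgHom.selfAdjointMap_lieProd _ _ _)
      (fun _ _ => StarAlgHom.selfAdjointMap_lieProd _ _ _)
      X.isLipNorm.lie_le Y.isLipNorm.lie_le norm_lieProd_sub_le

/-- If the Lip-ball of `X` is within `ε` of that of `Y`, then every `a` has a companion `b` at
distance at most `ε L(a)` with `L(b) ≤ L(a)`. -/
theorem exists_L_le_of_lipBall (hlt : ∀ a, X.L a < ∞) {ε : ℝ≥0}
    (h : ∀ a, X.L a ≤ 1 → ∃ b, Y.L b ≤ 1 ∧ ‖π.selfAdjointMap a - ρ.selfAdjointMap b‖₊ ≤ ε)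
    (a : selfAdjoint X.Alg) : ∃ b, Y.L b ≤ X.L a ∧
      (‖π.selfAdjointMap a - ρ.selfAdjointMap b‖₊ : ℝ≥0∞) ≤ ε * X.L a := by
  obtain h0 | h0 := eq_or_ne (X.L a) 0
  · obtain ⟨t, rfl⟩ := (X.isLipNorm.eq_zero_iff a).1 h0
    exact ⟨t • 1, by rw [Y.L_smul_one]; exact zero_le, by
      simp [StarAlgHom.selfAdjointMap_one]⟩
  · lift X.L a to ℝ≥0 using (hlt a).ne with r hr
    have hr0 : r ≠ 0 := by simpa using h0
    have h1 : X.L ((r : ℝ)⁻¹ • a) ≤ 1 := by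
      rw [X.isLipNorm.smul, abs_of_nonneg (by positivity), ENNReal.ofReal_inv_of_pos (by positivity),
        ENNReal.ofReal_coe_nnreal, ← hr, ENNReal.inv_mul_cancel h0 ENNReal.coe_ne_top]
    obtain ⟨b, hb, hab⟩ := h _ h1
    refine ⟨(r : ℝ) • b, ?_, ?_⟩
    · rw [Y.isLipNorm.smul, abs_of_nonneg r.coe_nonneg, ENNReal.ofReal_coe_nnreal]
      exact mul_le_of_le_one_right' hb
    · have : π.selfAdjointMap a - ρ.selfAdjointMap ((r : ℝ) • b) =
          (r : ℝ) • (π.selfAdjointMap ((r : ℝ)⁻¹ • a) - ρ.selfAdjointMap b) := by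
        rw [map_smul, map_smul, smul_sub, smul_inv_smul₀ (by exact_mod_cast hr0)]
      rw [this, nnnorm_smul, ← ENNReal.coe_mul, ENNReal.coe_le_coe, mul_comm]
      gcongr
      simp

/-- Two finite-dimensional spaces whose Lip-balls are within `ε` of each other in a common C*-algebra
are within `ε` for the dual propinquity. -/
theorem propinquity_le_of_lipBall [FiniteDimensional ℂ X.Alg] [FiniteDimensional ℂ Y.Alg]
    [Nontrivial M] (hF : Permissible F) {K : ℝ} (hK : 0 ≤ K) (hX : X.stateDiam ≤ ENNReal.ofReal K)
    (hY : Y.stateDiam ≤ ENNReal.ofReal K) (hπ : Function.Injective π) (hρ : Function.Injective ρ)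
    {ε : ℝ≥0} (hε : ε ≠ 0)
    (hXY : ∀ a, X.L a ≤ 1 → ∃ b, Y.L b ≤ 1 ∧ ‖π.selfAdjointMap a - ρ.selfAdjointMap b‖₊ ≤ ε)
    (hYX : ∀ b, Y.L b ≤ 1 → ∃ a, X.L a ≤ 1 ∧ ‖π.selfAdjointMap a - ρ.selfAdjointMap b‖₊ ≤ ε) :
    propinquity X Y ≤ ε := by
  have hYX' : ∀ b, Y.L b ≤ 1 →
      ∃ a, X.L a ≤ 1 ∧ ‖ρ.selfAdjointMap b - π.selfAdjointMap a‖₊ ≤ ε := fun b hb => by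
    obtain ⟨a, ha, h⟩ := hYX b hb
    exact ⟨a, ha, by rwa [← nnnorm_neg, neg_sub]⟩
  -- The weight `ε⁻¹` is small enough that companions within `ε L(a)` lift `a` without raising its
  -- Lip-norm, and large enough that the bridge seminorm is at most `ε` on the Lip-ball.
  let D : QQCMS.{u} F := ⟨X.Alg × Y.Alg, bridgeLipNorm π ρ ε⁻¹,
    isQuasiLeibnizLipNorm_bridgeLipNorm hF hK hX hY (inv_ne_zero hε)⟩
  have hε' : (ε : ℝ≥0∞) ≠ 0 := by exact_mod_cast hε
  have hle : ∀ (x : ℝ≥0) (y : ℝ≥0∞), (x : ℝ≥0∞) ≤ ε * y → ((ε⁻¹ * x : ℝ≥0) : ℝ≥0∞) ≤ y := by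
    intro x y h
    rw [ENNReal.coe_mul, ENNReal.coe_inv hε]
    calc (ε : ℝ≥0∞)⁻¹ * x ≤ (ε : ℝ≥0∞)⁻¹ * (ε * y) := by gcongr
      _ = y := by rw [← mul_assoc, ENNReal.inv_mul_cancel hε' ENNReal.coe_ne_top, one_mul]
  have hpair : ∀ (a : selfAdjoint X.Alg) (b : selfAdjoint Y.Alg),
      IsSelfAdjoint ((a, b) : X.Alg × Y.Alg) := fun a b => Prod.ext a.2 b.2
  let τ : Tunnel X Y :=
    { D := D
      π₁ := StarAlgHom.fst ℂ X.Alg Y.Alg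
      π₂ := StarAlgHom.snd ℂ X.Alg Y.Alg
      surjective₁ := Prod.fst_surjective
      surjective₂ := Prod.snd_surjective
      quotient₁ := fun a => by
        refine le_antisymm (le_iInf₂ fun d hd => ?_) ?_
        · obtain rfl : (StarAlgHom.fst ℂ X.Alg Y.Alg).selfAdjointMap d = a := Subtype.ext hd
          exact (le_max_left _ _).trans (le_max_left _ _)
        · obtain ⟨b, hb, hab⟩ := exists_L_le_of_lipBall X.isLipNorm.lt_top hXY a
          exact iInf_le_of_le (⟨(a, b), hpair a b⟩ : selfAdjoint (X.Alg × Y.Alg))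
            (iInf_le_of_le rfl (max_le (max_le le_rfl hb) (hle _ _ hab)))
      quotient₂ := fun b => by
        refine le_antisymm (le_iInf₂ fun d hd => ?_) ?_
        · obtain rfl : (StarAlgHom.snd ℂ X.Alg Y.Alg).selfAdjointMap d = b := Subtype.ext hd
          exact (le_max_right _ _).trans (le_max_left _ _)
        · obtain ⟨a, ha, hab⟩ := exists_L_le_of_lipBall Y.isLipNorm.lt_top hYX' b
          rw [← nnnorm_neg, neg_sub] at hab
          exact iInf_le_of_le (⟨(a, b), hpair a b⟩ : selfAdjoint (X.Alg × Y.Alg))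
            (iInf_le_of_le rfl (max_le (max_le ha le_rfl) (hle _ _ hab))) }
  have hball : ∀ d : selfAdjoint (X.Alg × Y.Alg), bridgeLipNorm π ρ ε⁻¹ d ≤ 1 →
      bridgeSeminorm π ρ d ≤ ε := fun d hd => by
    have := (le_max_right _ _).trans hd
    rwa [ENNReal.coe_le_one_iff, inv_mul_le_iff₀ (pos_iff_ne_zero.2 hε), mul_one] at this
  -- In `M × M`, the pair `(π a, ρ b)` is compared with `(π a, π a)` for the first projection and
  -- with `(ρ b, ρ b)` for the second. Both distances are the bridge seminorm, so states of the
  -- product have companions on either factor.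
  let β : X.Alg × Y.Alg →⋆ₐ[ℂ] M × M :=
    (π.comp (StarAlgHom.fst ℂ _ _)).prod (ρ.comp (StarAlgHom.snd ℂ _ _))
  have hβ : Function.Injective β := fun c d h =>
    Prod.ext (hπ (congrArg Prod.fst h)) (hρ (congrArg Prod.snd h))
  have hstate : ∀ {Z : QQCMS.{u} F} (q : X.Alg × Y.Alg →⋆ₐ[ℂ] Z.Alg) (α : Z.Alg →⋆ₐ[ℂ] M × M),
      (∀ d : selfAdjoint (X.Alg × Y.Alg), ‖β d - α (q d)‖ ≤ bridgeSeminorm π ρ d) →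
      D.hausdorff Set.univ (Set.range (StateSpace.comap q)) ≤ ε := by
    intro Z q α hα
    let _ := mongeKantorovichSpace D.L
    refine Metric.hausdorffEDist_le_of_mem_edist (fun φ _ => ?_) (fun φ _ => ⟨φ, trivial, ?_⟩)
    · obtain ⟨ψ, hψ⟩ := StateSpace.exists_norm_sub_le hβ α φ
      refine ⟨_, ⟨ψ, rfl⟩, iSup₂_le fun d hd => ?_⟩
      rw [edist_dist, dist_eq_norm]
      refine ENNReal.ofReal_le_of_le_toReal ?_
      exact (hψ (q.selfAdjointMap d) d).trans ((hα d).trans (hball d hd))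
    · rw [edist_self]; exact zero_le
  refine (iInf_le _ τ).trans (max_le ?_ ?_)
  · refine hstate (StarAlgHom.fst ℂ X.Alg Y.Alg) (π.prod π) fun d => ?_
    change max ‖_‖ ‖_‖ ≤ _
    refine max_le ?_ ?_
    · change ‖π (d : X.Alg × Y.Alg).1 - π (d : X.Alg × Y.Alg).1‖ ≤ _
      simp
    · rw [← norm_neg]
      change ‖-(ρ (d : X.Alg × Y.Alg).2 - π (d : X.Alg × Y.Alg).1)‖ ≤ _
      rw [neg_sub]; exact le_rfl
  · refine hstate (StarAlgHom.snd ℂ X.Alg Y.Alg) (ρ.prod ρ) fun d => ?_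
    change max ‖_‖ ‖_‖ ≤ _
    refine max_le le_rfl ?_
    change ‖ρ (d : X.Alg × Y.Alg).2 - ρ (d : X.Alg × Y.Alg).2‖ ≤ _
    simp

theorem propinquity_comm_le (X Y : QQCMS.{u} F) : propinquity Y X ≤ propinquity X Y :=
  le_iInf fun τ => (iInf_le _ (⟨τ.D, τ.π₂, τ.π₁, τ.surjective₂, τ.surjective₁, τ.quotient₂,
    τ.quotient₁⟩ : Tunnel Y X)).trans (max_comm _ _).le

end Bridge

/-! ### Limits of Lip-balls along an ultrafilter -/

section Ultraproduct

theorem Ultrafilter.exists_tendsto_of_norm_le {ι E : Type*} [SeminormedAddCommGroup E] [ProperSpace E]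
    (𝒰 : Ultrafilter ι) {s : ι → E} {C : ℝ} (h : ∀ᶠ i in 𝒰, ‖s i‖ ≤ C) :
    ∃ z, Tendsto s 𝒰 (𝓝 z) := by
  obtain ⟨z, -, hz⟩ := (isCompact_closedBall (0 : E) C).ultrafilter_le_nhds (𝒰.map s) (by
    rw [le_principal_iff, Ultrafilter.mem_coe, Ultrafilter.mem_map]
    filter_upwards [h] with i hi
    simpa using hi)
  exact ⟨z, hz⟩

theorem StarAlgHom.norm_selfAdjointMap {A B : Type*} [CStarAlgebra A] [CStarAlgebra B]
    {π : A →⋆ₐ[ℂ] B} (hπ : Function.Injective π) (a : selfAdjoint A) : ‖π.selfAdjointMap a‖ = ‖a‖ :=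
  NonUnitalStarAlgHom.norm_map π hπ _

variable {ι : Type*} {𝒰 : Ultrafilter ι} {x : ι → QQCMS.{u} F} {M : Type u} [CStarAlgebra M]
  {π : ∀ i, (x i).Alg →⋆ₐ[ℂ] M}

variable (𝒰 π) in
/-- `z` is a limit, along the ultrafilter, of elements whose Lip-norm is at most `r`. -/
def IsLipLimit (r : ℝ≥0) (z : selfAdjoint M) : Prop :=
  ∃ a : ∀ i, selfAdjoint (x i).Alg, (∀ᶠ i in 𝒰, (x i).L (a i) ≤ r) ∧
    Tendsto (fun i => (π i).selfAdjointMap (a i)) 𝒰 (𝓝 z)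

theorem IsLipLimit.mono {r s : ℝ≥0} (hrs : r ≤ s) {z : selfAdjoint M} (h : IsLipLimit 𝒰 π r z) :
    IsLipLimit 𝒰 π s z := by
  obtain ⟨a, ha, hz⟩ := h
  exact ⟨a, ha.mono fun i hi => hi.trans (by exact_mod_cast hrs), hz⟩

theorem IsLipLimit.add {r s : ℝ≥0} {z w : selfAdjoint M} (hz : IsLipLimit 𝒰 π r z)
    (hw : IsLipLimit 𝒰 π s w) : IsLipLimit 𝒰 π (r + s) (z + w) := by
  obtain ⟨a, ha, hz⟩ := hz
  obtain ⟨b, hb, hw⟩ := hw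
  refine ⟨fun i => a i + b i, ?_, by simpa using hz.add hw⟩
  filter_upwards [ha, hb] with i hai hbi
  exact ((x i).isLipNorm.add_le _ _).trans (by push_cast; exact add_le_add hai hbi)

theorem IsLipLimit.smul {r : ℝ≥0} {z : selfAdjoint M} (hz : IsLipLimit 𝒰 π r z) (t : ℝ) :
    IsLipLimit 𝒰 π (‖t‖₊ * r) (t • z) := by
  obtain ⟨a, ha, hz⟩ := hz
  refine ⟨fun i => t • a i, ?_, by simpa using hz.const_smul t⟩
  filter_upwards [ha] with i hai
  rw [(x i).isLipNorm.smul, ← Real.norm_eq_abs, ofReal_norm, ENNReal.coe_mul]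
  exact mul_le_mul' le_rfl hai

theorem isLipLimit_smul_one (t : ℝ) : IsLipLimit 𝒰 π 0 (t • 1) :=
  ⟨fun _ => t • 1, .of_forall fun i => by simp [(x i).L_smul_one], by
    simp [StarAlgHom.selfAdjointMap_one]⟩

theorem IsLipLimit.add_smul_one {r : ℝ≥0} {z : selfAdjoint M} (hz : IsLipLimit 𝒰 π r z) (t : ℝ) :
    IsLipLimit 𝒰 π r (z + t • 1) := by
  simpa using hz.add (isLipLimit_smul_one t)

theorem QQCMS.isClosed_L_le (X : QQCMS.{u} F) [FiniteDimensional ℂ X.Alg] (r : ℝ≥0) :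
    IsClosed {a | X.L a ≤ r} := by
  obtain rfl | hr := eq_or_ne r 0
  · have : {a | X.L a ≤ (0 : ℝ≥0)} =
        (Submodule.span ℝ {(1 : selfAdjoint X.Alg)} : Set (selfAdjoint X.Alg)) := by
      ext a
      simp [X.isLipNorm.eq_zero_iff, Submodule.mem_span_singleton, eq_comm]
    rw [this]
    exact Submodule.closed_of_finiteDimensional _
  · have : {a | X.L a ≤ r} = (fun a => (r : ℝ)⁻¹ • a) ⁻¹' {a | X.L a ≤ 1} := by
      ext a
      have hr' : (r : ℝ≥0∞) ≠ 0 := by exact_mod_cast hr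
      simp only [Set.mem_ofPred_eq, Set.mem_preimage]
      rw [X.isLipNorm.smul, abs_of_nonneg (by positivity),
        ENNReal.ofReal_inv_of_pos (by positivity), ENNReal.ofReal_coe_nnreal,
        mul_comm, ← div_eq_mul_inv, ENNReal.div_le_iff hr' ENNReal.coe_ne_top, one_mul]
    rw [this]
    exact X.isLipNorm.isClosed_ball.preimage (continuous_const_smul _)

/-- The images of the balls are closed in a proper space, so nearest points to `z` exist; they form
one family that serves every `ε`. -/
theorem isLipLimit_iff [FiniteDimensional ℂ M] [∀ i, FiniteDimensional ℂ (x i).Alg] (hπ : ∀ i, Function.Injective (π i))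
    {r : ℝ≥0} {z : selfAdjoint M} : IsLipLimit 𝒰 π r z ↔
      ∀ ε > 0, ∀ᶠ i in 𝒰, ∃ a, (x i).L a ≤ r ∧ ‖(π i).selfAdjointMap a - z‖ < ε := by
  constructor
  · rintro ⟨a, ha, hz⟩ ε hε
    filter_upwards [ha, Metric.tendsto_nhds.1 hz ε hε] with i hi hd
    exact ⟨a i, hi, by rwa [← dist_eq_norm]⟩
  · intro h
    have hcl : ∀ i, IsClosed ((π i).selfAdjointMap '' {a | (x i).L a ≤ r}) := fun i =>
      (AddMonoidHomClass.isometry_of_norm (π i).selfAdjointMap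
        (StarAlgHom.norm_selfAdjointMap (hπ i))).isClosedEmbedding.isClosedMap _
        ((x i).isClosed_L_le r)
    have hne : ∀ i, ((π i).selfAdjointMap '' {a | (x i).L a ≤ r}).Nonempty := fun i =>
      ⟨_, (0 : ℝ) • 1, by simp only [Set.mem_ofPred_eq, (x i).L_smul_one, zero_le], rfl⟩
    have : ProperSpace (selfAdjoint M) := FiniteDimensional.proper ℝ _
    have hex : ∀ i, ∃ a, (x i).L a ≤ r ∧
        Metric.infDist z ((π i).selfAdjointMap '' {a | (x i).L a ≤ r}) =
          dist z ((π i).selfAdjointMap a) := by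
      intro i
      obtain ⟨_, ⟨a, ha, rfl⟩, hd⟩ := (hcl i).exists_infDist_eq_dist (hne i) z
      exact ⟨a, ha, hd⟩
    choose a ha hd using hex
    refine ⟨a, .of_forall ha, Metric.tendsto_nhds.2 fun ε hε => ?_⟩
    filter_upwards [h ε hε] with i hi
    obtain ⟨b, hb, hbz⟩ := hi
    have h1 : Metric.infDist z ((π i).selfAdjointMap '' {a | (x i).L a ≤ r}) ≤
      dist z ((π i).selfAdjointMap b) := Metric.infDist_le_dist_of_mem ⟨b, hb, rfl⟩
    rw [dist_comm, ← hd i]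
    rw [dist_comm, dist_eq_norm] at h1
    exact h1.trans_lt hbz

theorem isClosed_isLipLimit [FiniteDimensional ℂ M] [∀ i, FiniteDimensional ℂ (x i).Alg]
    (hπ : ∀ i, Function.Injective (π i)) (r : ℝ≥0) : IsClosed {z | IsLipLimit 𝒰 π r z} := by
  refine isClosed_of_closure_subset fun z hz => (isLipLimit_iff hπ).2 fun ε hε => ?_
  obtain ⟨w, hw, hzw⟩ := Metric.mem_closure_iff.1 hz (ε / 2) (half_pos hε)
  filter_upwards [(isLipLimit_iff hπ).1 hw (ε / 2) (half_pos hε)] with i ⟨a, ha, haw⟩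
  refine ⟨a, ha, ?_⟩
  rw [← dist_eq_norm] at haw ⊢
  calc dist _ z ≤ dist _ w + dist w z := dist_triangle _ _ _
    _ < ε := by rw [dist_comm w z]; linarith

/-- After rescaling to `r = 1`, a single index suffices: an element of its Lip-ball lies within `1`
of the limit and within `K` of the scalars. The linear dependence on `r` is what later identifies
the kernel. -/
theorem IsLipLimit.exists_norm_sub_le [Nontrivial M] {K : ℝ} (hK : 0 ≤ K)
    (hx : ∀ i, (x i).stateDiam ≤ ENNReal.ofReal K) {r : ℝ≥0} (hr : r ≠ 0) {z : selfAdjoint M}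
    (hz : IsLipLimit 𝒰 π r z) : ∃ t : ℝ, ‖z - t • (1 : selfAdjoint M)‖ ≤ r * (K + 1) := by
  have hr' : (0 : ℝ) < r := by positivity
  have h1 := hz.smul (r : ℝ)⁻¹
  have hr1 : ‖(r : ℝ)⁻¹‖₊ * r = 1 := by
    rw [nnnorm_inv, NNReal.nnnorm_eq, inv_mul_cancel₀ hr]
  rw [hr1] at h1
  obtain ⟨a, ha, hlim⟩ := h1
  obtain ⟨i, hi, hd⟩ := (ha.and (Metric.tendsto_nhds.1 hlim 1 one_pos)).exists
  obtain ⟨t, ht⟩ := (x i).norm_sub_le (hx i) hK (by exact_mod_cast hi)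
  have h2 : ‖(π i).selfAdjointMap (a i - t • 1)‖ ≤ K :=
    (NonUnitalStarAlgHom.norm_apply_le (π i) _).trans ht
  rw [map_sub, map_smul, StarAlgHom.selfAdjointMap_one] at h2
  rw [dist_eq_norm] at hd
  refine ⟨r * t, ?_⟩
  have h3 : z - ((r : ℝ) * t) • (1 : selfAdjoint M) =
      (r : ℝ) • (((π i).selfAdjointMap (a i) - t • 1) -
        ((π i).selfAdjointMap (a i) - (r : ℝ)⁻¹ • z)) := by
    rw [sub_sub_sub_cancel_left, smul_sub, smul_inv_smul₀ hr'.ne', smul_smul]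
  rw [h3, norm_smul, NNReal.norm_eq]
  gcongr
  exact (norm_sub_le _ _).trans (by linarith)

/-- The bound at index `i` involves the norms of the approximants, which only converge to those of
`z` and `w`; continuity of `F` absorbs this in `δ`. -/
theorem IsLipLimit.prod (hF : StronglyPermissible F) (hπ : ∀ i, Function.Injective (π i))
    {P : ∀ (A : Type u) [CStarAlgebra A], selfAdjoint A → selfAdjoint A → selfAdjoint A}
    (hP : ∀ i a b, (π i).selfAdjointMap (P _ a b) =
      P _ ((π i).selfAdjointMap a) ((π i).selfAdjointMap b))
    (hPcont : Continuous fun p : selfAdjoint M × selfAdjoint M => P M p.1 p.2)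
    (hPx : ∀ i a b, (x i).L a < ∞ → (x i).L b < ∞ → (x i).L (P _ a b) ≤
      F (‖(a : (x i).Alg)‖₊, ‖(b : (x i).Alg)‖₊, ((x i).L a).toNNReal, ((x i).L b).toNNReal))
    {r s δ : ℝ≥0} (hδ : 0 < δ) {z w : selfAdjoint M} (hz : IsLipLimit 𝒰 π r z)
    (hw : IsLipLimit 𝒰 π s w) :
    IsLipLimit 𝒰 π (F (‖z‖₊, ‖w‖₊, r, s) + δ) (P M z w) := by
  obtain ⟨a, ha, hz⟩ := hz
  obtain ⟨b, hb, hw⟩ := hw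
  refine ⟨fun i => P _ (a i) (b i), ?_, ?_⟩
  · have hlim : Tendsto (fun i => F (‖(π i).selfAdjointMap (a i)‖₊, ‖(π i).selfAdjointMap (b i)‖₊,
        r, s)) 𝒰 (𝓝 (F (‖z‖₊, ‖w‖₊, r, s))) :=
      (hF.continuous.tendsto _).comp (hz.nnnorm.prodMk_nhds (hw.nnnorm.prodMk_nhds
        (tendsto_const_nhds.prodMk_nhds tendsto_const_nhds)))
    filter_upwards [ha, hb, hlim.eventually_lt_const (lt_add_of_pos_right _ hδ)] with i hai hbi hi
    have hna : ∀ c : selfAdjoint (x i).Alg, ‖(c : (x i).Alg)‖₊ = ‖(π i).selfAdjointMap c‖₊ :=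
      fun c => NNReal.eq (StarAlgHom.norm_selfAdjointMap (hπ i) c).symm
    refine (hPx i _ _ (hai.trans_lt ENNReal.coe_lt_top) (hbi.trans_lt ENNReal.coe_lt_top)).trans
      (ENNReal.coe_le_coe.2 ((hF.monotone ?_).trans hi.le))
    exact Prod.mk_le_mk.2 ⟨(hna _).le, Prod.mk_le_mk.2 ⟨(hna _).le, Prod.mk_le_mk.2
      ⟨ENNReal.toNNReal_mono ENNReal.coe_ne_top hai, ENNReal.toNNReal_mono ENNReal.coe_ne_top hbi⟩⟩⟩
  · simp only [hP]
    exact (hPcont.tendsto (z, w)).comp (hz.prodMk_nhds hw)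

variable (𝒰 π) in
/-- The limit of the Lip-norms along the ultrafilter. -/
noncomputable def lipLimitNorm (z : selfAdjoint M) : ℝ≥0∞ :=
  ⨅ (r : ℝ≥0) (_ : 0 < r ∧ IsLipLimit 𝒰 π r z), (r : ℝ≥0∞)

theorem lipLimitNorm_lt_iff {z : selfAdjoint M} {s : ℝ≥0∞} :
    lipLimitNorm 𝒰 π z < s ↔ ∃ r : ℝ≥0, (0 < r ∧ IsLipLimit 𝒰 π r z) ∧ (r : ℝ≥0∞) < s := by
  simp only [lipLimitNorm, iInf_lt_iff, exists_prop]

/-- The infimum runs over positive radii only, hence the `ε` of room for the case `r = 0`. -/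
theorem IsLipLimit.lipLimitNorm_le {r : ℝ≥0} {z : selfAdjoint M} (hz : IsLipLimit 𝒰 π r z) :
    lipLimitNorm 𝒰 π z ≤ r := by
  refine ENNReal.le_of_forall_pos_le_add fun ε hε _ => ?_
  rw [← ENNReal.coe_add]
  exact iInf₂_le (r + ε) ⟨by positivity, hz.mono le_self_add⟩

theorem IsLipLimit.lipLimitNorm_lt_top {r : ℝ≥0} {z : selfAdjoint M} (hz : IsLipLimit 𝒰 π r z) :
    lipLimitNorm 𝒰 π z < ∞ :=
  hz.lipLimitNorm_le.trans_lt ENNReal.coe_lt_top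

theorem isLipLimit_of_lt {z : selfAdjoint M} {r : ℝ≥0} (h : lipLimitNorm 𝒰 π z < r) :
    IsLipLimit 𝒰 π r z := by
  obtain ⟨s, ⟨-, hs⟩, hsr⟩ := lipLimitNorm_lt_iff.1 h
  exact hs.mono (by exact_mod_cast hsr.le)

theorem isLipLimit_toNNReal_add {z : selfAdjoint M} (h : lipLimitNorm 𝒰 π z < ∞) {δ : ℝ≥0}
    (hδ : 0 < δ) : IsLipLimit 𝒰 π ((lipLimitNorm 𝒰 π z).toNNReal + δ) z := by
  apply isLipLimit_of_lt
  rw [ENNReal.coe_add, ENNReal.coe_toNNReal h.ne]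
  exact ENNReal.lt_add_right h.ne (by exact_mod_cast hδ.ne')

/-- The infimum is attained: `z` has radius `r + δ` for every `δ > 0`, so `(r / (r + δ)) • z` has
radius `r`, and the set of such limits is closed. -/
theorem lipLimitNorm_le_iff [FiniteDimensional ℂ M] [∀ i, FiniteDimensional ℂ (x i).Alg]
    (hπ : ∀ i, Function.Injective (π i)) {r : ℝ≥0} (hr : r ≠ 0) {z : selfAdjoint M} :
    lipLimitNorm 𝒰 π z ≤ r ↔ IsLipLimit 𝒰 π r z := by
  refine ⟨fun h => ?_, IsLipLimit.lipLimitNorm_le⟩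
  have hlim : Tendsto (fun δ : ℝ => ((r : ℝ) / (r + δ)) • z) (𝓝[>] 0) (𝓝 z) := by
    have h1 : ContinuousAt (fun δ : ℝ => (r : ℝ) / (r + δ)) 0 :=
      ContinuousAt.div continuousAt_const (by fun_prop) (by simpa using hr)
    have h2 := h1.tendsto.smul_const z
    have hr' : (r : ℝ) ≠ 0 := by exact_mod_cast hr
    simp only [add_zero, div_self hr', one_smul] at h2
    exact h2.mono_left nhdsWithin_le_nhds
  refine (isClosed_isLipLimit hπ r).mem_of_tendsto hlim ?_
  filter_upwards [self_mem_nhdsWithin] with δ hδ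
  lift δ to ℝ≥0 using (le_of_lt hδ)
  have hδ' : 0 < δ := by exact_mod_cast hδ
  have h1 : IsLipLimit 𝒰 π (r + δ) z := isLipLimit_of_lt (h.trans_lt (by
    exact_mod_cast lt_add_of_pos_right _ hδ'))
  have h2 := h1.smul ((r : ℝ) / (r + δ))
  have h3 : ‖(r : ℝ) / (r + δ)‖₊ * (r + δ) = r := by
    have : ((r : ℝ) / (r + δ)) = ((r / (r + δ) : ℝ≥0) : ℝ) := by push_cast; rfl
    rw [this, NNReal.nnnorm_eq, div_mul_cancel₀]
    positivity
  rwa [h3] at h2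

theorem lipLimitNorm_add_le (z w : selfAdjoint M) :
    lipLimitNorm 𝒰 π (z + w) ≤ lipLimitNorm 𝒰 π z + lipLimitNorm 𝒰 π w := by
  refine ENNReal.le_of_forall_pos_le_add fun ε hε h => ?_
  obtain ⟨hz, hw⟩ := ENNReal.add_lt_top.1 h
  have h1 := ((isLipLimit_toNNReal_add hz (half_pos hε)).add
    (isLipLimit_toNNReal_add hw (half_pos hε))).lipLimitNorm_le
  refine h1.trans (le_of_eq ?_)
  push_cast
  rw [ENNReal.coe_toNNReal hz.ne, ENNReal.coe_toNNReal hw.ne, add_add_add_comm, ENNReal.add_halves]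

theorem lipLimitNorm_smul_le (t : ℝ) (z : selfAdjoint M) (h : lipLimitNorm 𝒰 π z < ∞) :
    lipLimitNorm 𝒰 π (t • z) ≤ ENNReal.ofReal |t| * lipLimitNorm 𝒰 π z := by
  have ht : ENNReal.ofReal |t| = (‖t‖₊ : ℝ≥0∞) := by rw [← Real.norm_eq_abs, ofReal_norm]; rfl
  have h2 : lipLimitNorm 𝒰 π z = ((lipLimitNorm 𝒰 π z).toNNReal : ℝ≥0∞) :=
    (ENNReal.coe_toNNReal h.ne).symm
  have key : ∀ δ : ℝ≥0, 0 < δ → lipLimitNorm 𝒰 π (t • z) ≤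
      (‖t‖₊ * ((lipLimitNorm 𝒰 π z).toNNReal + δ) : ℝ≥0) := fun δ hδ =>
    ((isLipLimit_toNNReal_add h hδ).smul t).lipLimitNorm_le
  rw [ht, h2, ← ENNReal.coe_mul]
  refine ENNReal.le_of_forall_pos_le_add fun ε hε _ => ?_
  refine (key (ε / (‖t‖₊ + 1)) (by positivity)).trans ?_
  rw [← ENNReal.coe_add, ENNReal.coe_le_coe, mul_add]
  gcongr
  rw [← mul_div_assoc, mul_comm, mul_div_assoc]
  exact mul_le_of_le_one_right' (div_le_one_of_le₀ le_self_add (by positivity))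

theorem lipLimitNorm_prod_le (hF : StronglyPermissible F) (hπ : ∀ i, Function.Injective (π i))
    {P : ∀ (A : Type u) [CStarAlgebra A], selfAdjoint A → selfAdjoint A → selfAdjoint A}
    (hP : ∀ i a b, (π i).selfAdjointMap (P _ a b) =
      P _ ((π i).selfAdjointMap a) ((π i).selfAdjointMap b))
    (hPcont : Continuous fun p : selfAdjoint M × selfAdjoint M => P M p.1 p.2)
    (hPx : ∀ i a b, (x i).L a < ∞ → (x i).L b < ∞ → (x i).L (P _ a b) ≤
      F (‖(a : (x i).Alg)‖₊, ‖(b : (x i).Alg)‖₊, ((x i).L a).toNNReal, ((x i).L b).toNNReal))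
    {z w : selfAdjoint M} (hz : lipLimitNorm 𝒰 π z < ∞) (hw : lipLimitNorm 𝒰 π w < ∞) :
    lipLimitNorm 𝒰 π (P M z w) ≤
      F (‖z‖₊, ‖w‖₊, (lipLimitNorm 𝒰 π z).toNNReal, (lipLimitNorm 𝒰 π w).toNNReal) := by
  set r := (lipLimitNorm 𝒰 π z).toNNReal
  set s := (lipLimitNorm 𝒰 π w).toNNReal
  have hlim : Tendsto (fun δ : ℝ≥0 => ((F (‖z‖₊, ‖w‖₊, r + δ, s + δ) + δ : ℝ≥0) : ℝ≥0∞)) (𝓝[>] 0)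
      (𝓝 (F (‖z‖₊, ‖w‖₊, r, s))) := by
    have hc : Continuous (fun δ : ℝ≥0 => F (‖z‖₊, ‖w‖₊, r + δ, s + δ) + δ) :=
      (hF.continuous.comp (by fun_prop)).add continuous_id
    have h2 := (ENNReal.continuous_coe.comp hc).tendsto 0
    simp only [Function.comp, add_zero] at h2
    exact h2.mono_left nhdsWithin_le_nhds
  refine ge_of_tendsto hlim ?_
  filter_upwards [self_mem_nhdsWithin] with δ hδ
  exact (IsLipLimit.prod hF hπ hP hPcont hPx hδ (isLipLimit_toNNReal_add hz hδ)
    (isLipLimit_toNNReal_add hw hδ)).lipLimitNorm_le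

end Ultraproduct

/-! ### The limit quantum compact metric space -/

section LimitSpace

theorem continuous_jordanProd {A : Type u} [CStarAlgebra A] :
    Continuous fun p : selfAdjoint A × selfAdjoint A => jordanProd p.1 p.2 := by
  refine Continuous.subtype_mk ?_ _
  fun_prop

theorem continuous_lieProd {A : Type u} [CStarAlgebra A] :
    Continuous fun p : selfAdjoint A × selfAdjoint A => lieProd p.1 p.2 := by
  refine Continuous.subtype_mk ?_ _
  fun_prop

variable {ι : Type*} {𝒰 : Ultrafilter ι} {x : ι → QQCMS.{u} F} {M : Type u} [CStarAlgebra M]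
  {π : ∀ i, (x i).Alg →⋆ₐ[ℂ] M}

variable (𝒰 π) in
/-- The complex span of the domain of the limit of the Lip-norms. -/
noncomputable def lipLimitSubmodule : Submodule ℂ M where
  carrier := {z | lipLimitNorm 𝒰 π (ℜ z) < ∞ ∧ lipLimitNorm 𝒰 π (ℑ z) < ∞}
  add_mem' {z w} hz hw := by
    simp only [Set.mem_ofPred_eq, map_add]
    exact ⟨(lipLimitNorm_add_le _ _).trans_lt (ENNReal.add_lt_top.2 ⟨hz.1, hw.1⟩),
      (lipLimitNorm_add_le _ _).trans_lt (ENNReal.add_lt_top.2 ⟨hz.2, hw.2⟩)⟩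
  zero_mem' := by
    have : lipLimitNorm 𝒰 π 0 < ∞ := by
      simpa using (isLipLimit_smul_one (𝒰 := 𝒰) (π := π) 0).lipLimitNorm_lt_top
    simp [this]
  smul_mem' c z hz := by
    have h : ∀ (t : ℝ) (w : selfAdjoint M), lipLimitNorm 𝒰 π w < ∞ →
        lipLimitNorm 𝒰 π (t • w) < ∞ := fun t w hw =>
      (lipLimitNorm_smul_le t w hw).trans_lt (ENNReal.mul_lt_top ENNReal.ofReal_lt_top hw)
    simp only [Set.mem_ofPred_eq, realPart_smul, imaginaryPart_smul, sub_eq_add_neg, ← neg_smul]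
    exact ⟨(lipLimitNorm_add_le _ _).trans_lt (ENNReal.add_lt_top.2 ⟨h _ _ hz.1, h _ _ hz.2⟩),
      (lipLimitNorm_add_le _ _).trans_lt (ENNReal.add_lt_top.2 ⟨h _ _ hz.2, h _ _ hz.1⟩)⟩

theorem coe_mem_lipLimitSubmodule {z : selfAdjoint M} :
    (z : M) ∈ lipLimitSubmodule 𝒰 π ↔ lipLimitNorm 𝒰 π z < ∞ := by
  have hre : ℜ (z : M) = z := Subtype.ext (IsSelfAdjoint.coe_realPart z.2)
  have him : ℑ (z : M) = 0 := IsSelfAdjoint.imaginaryPart z.2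
  change lipLimitNorm 𝒰 π (ℜ (z : M)) < ∞ ∧ lipLimitNorm 𝒰 π (ℑ (z : M)) < ∞ ↔ _
  rw [hre, him]
  refine and_iff_left ?_
  simpa using (isLipLimit_smul_one (𝒰 := 𝒰) (π := π) 0).lipLimitNorm_lt_top

/-- For self-adjoint elements `a b = a ∘ b + i {a, b}`, and both products have finite Lip-norm
because `F` takes finite values. -/
theorem mul_mem_lipLimitSubmodule (hF : StronglyPermissible F)
    (hπ : ∀ i, Function.Injective (π i)) {z w : M} (hz : z ∈ lipLimitSubmodule 𝒰 π)
    (hw : w ∈ lipLimitSubmodule 𝒰 π) : z * w ∈ lipLimitSubmodule 𝒰 π := by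
  have key : ∀ a b : selfAdjoint M, lipLimitNorm 𝒰 π a < ∞ → lipLimitNorm 𝒰 π b < ∞ →
      (a : M) * b ∈ lipLimitSubmodule 𝒰 π := by
    intro a b ha hb
    have h1 : (jordanProd a b : M) ∈ lipLimitSubmodule 𝒰 π := coe_mem_lipLimitSubmodule.2
      ((lipLimitNorm_prod_le hF hπ (P := fun A _ => jordanProd)
        (fun i => (π i).selfAdjointMap_jordanProd) continuous_jordanProd
        (fun i => (x i).isLipNorm.jordan_le) ha hb).trans_lt ENNReal.coe_lt_top)
    have h2 : (lieProd a b : M) ∈ lipLimitSubmodule 𝒰 π := coe_mem_lipLimitSubmodule.2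
      ((lipLimitNorm_prod_le hF hπ (P := fun A _ => lieProd)
        (fun i => (π i).selfAdjointMap_lieProd) continuous_lieProd
        (fun i => (x i).isLipNorm.lie_le) ha hb).trans_lt ENNReal.coe_lt_top)
    have h3 : (a : M) * b = (jordanProd a b : M) + Complex.I • (lieProd a b : M) := by
      change (a : M) * b = (1 / 2 : ℂ) • ((a : M) * b + b * a) +
        Complex.I • (1 / (2 * Complex.I) : ℂ) • ((a : M) * b - b * a)
      have : Complex.I * (1 / (2 * Complex.I)) = 1 / 2 := by
        field_simp
      rw [smul_smul, this, ← smul_add]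
      rw [add_add_sub_cancel, ← two_smul ℂ, smul_smul]
      norm_num
    rw [h3]
    exact add_mem h1 (Submodule.smul_mem _ _ h2)
  rw [← realPart_add_I_smul_imaginaryPart z, ← realPart_add_I_smul_imaginaryPart w, add_mul, mul_add,
    mul_add, smul_mul_assoc, smul_mul_assoc, mul_smul_comm, mul_smul_comm]
  exact add_mem (add_mem (key _ _ hz.1 hw.1) (Submodule.smul_mem _ _ (key _ _ hz.1 hw.2)))
    (add_mem (Submodule.smul_mem _ _ (key _ _ hz.2 hw.1))
      (Submodule.smul_mem _ _ (Submodule.smul_mem _ _ (key _ _ hz.2 hw.2))))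

/-- An element of norm zero is a limit of radius `r` for every `r > 0`, hence within `r * (K + 1)`
of the scalars, which form a closed line. -/
theorem lipLimitNorm_eq_zero_iff [Nontrivial M] {K : ℝ} (hK : 0 ≤ K)
    (hx : ∀ i, (x i).stateDiam ≤ ENNReal.ofReal K) {z : selfAdjoint M} :
    lipLimitNorm 𝒰 π z = 0 ↔ ∃ t : ℝ, z = t • (1 : selfAdjoint M) := by
  constructor
  · intro h
    have hcl : IsClosed (Submodule.span ℝ {(1 : selfAdjoint M)} : Set (selfAdjoint M)) :=
      Submodule.closed_of_finiteDimensional _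
    have hmem : z ∈ closure (Submodule.span ℝ {(1 : selfAdjoint M)} : Set (selfAdjoint M)) := by
      rw [Metric.mem_closure_iff]
      intro ε hε
      lift ε to ℝ≥0 using hε.le
      obtain ⟨K, rfl⟩ : ∃ k : ℝ≥0, K = k := ⟨⟨K, hK⟩, rfl⟩
      have hε' : ε ≠ 0 := by rintro rfl; simp at hε
      have hr : ε / (2 * (K + 1)) ≠ 0 := by positivity
      obtain ⟨t, ht⟩ := (isLipLimit_of_lt (h.trans_lt (by exact_mod_cast pos_iff_ne_zero.2 hr))
        : IsLipLimit 𝒰 π (ε / (2 * (K + 1))) z).exists_norm_sub_le K.coe_nonneg hx hr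
      refine ⟨t • 1, Submodule.smul_mem _ _ (Submodule.mem_span_singleton_self _), ?_⟩
      rw [dist_eq_norm]
      refine ht.trans_lt ?_
      push_cast
      have hK1 : (0 : ℝ) < K + 1 := by positivity
      rw [div_mul_eq_mul_div, mul_div_mul_right _ _ hK1.ne']
      exact half_lt_self hε
    rw [hcl.closure_eq] at hmem
    obtain ⟨t, ht⟩ := Submodule.mem_span_singleton.1 hmem
    exact ⟨t, ht.symm⟩
  · rintro ⟨t, rfl⟩
    simpa using (isLipLimit_smul_one (𝒰 := 𝒰) (π := π) t).lipLimitNorm_le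

/-- The C*-algebra generated by the limit of the Lip-balls. -/
noncomputable def lipLimitSubalgebra (𝒰 : Ultrafilter ι) (hF : StronglyPermissible F)
    (hπ : ∀ i, Function.Injective (π i)) : StarSubalgebra ℂ M where
  __ := lipLimitSubmodule 𝒰 π
  mul_mem' := mul_mem_lipLimitSubmodule hF hπ
  one_mem' := coe_mem_lipLimitSubmodule (z := 1).2 (by
    simpa using (isLipLimit_smul_one (𝒰 := 𝒰) (π := π) 1).lipLimitNorm_lt_top)
  algebraMap_mem' c := by
    rw [Algebra.algebraMap_eq_smul_one]
    exact Submodule.smul_mem _ _ (coe_mem_lipLimitSubmodule (z := 1).2 (by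
      simpa using (isLipLimit_smul_one (𝒰 := 𝒰) (π := π) 1).lipLimitNorm_lt_top))
  star_mem' {z} hz := by
    rw [← realPart_add_I_smul_imaginaryPart z, star_add, star_smul, selfAdjoint.star_val_eq,
      selfAdjoint.star_val_eq]
    exact add_mem (coe_mem_lipLimitSubmodule.2 hz.1)
      (Submodule.smul_mem _ _ (coe_mem_lipLimitSubmodule.2 hz.2))

variable [FiniteDimensional ℂ M]

instance StarSubalgebra.isClosed_of_finiteDimensional (B : StarSubalgebra ℂ M) :
    IsClosed (B : Set M) :=
  (Subalgebra.toSubmodule B.toSubalgebra).closed_of_finiteDimensional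

instance (B : StarSubalgebra ℂ M) : FiniteDimensional ℂ B :=
  FiniteDimensional.finiteDimensional_submodule (Subalgebra.toSubmodule B.toSubalgebra)

variable {hF : StronglyPermissible F} {hπ : ∀ i, Function.Injective (π i)}

theorem lipLimitNorm_subtype_lt_top (a : selfAdjoint (lipLimitSubalgebra 𝒰 hF hπ)) :
    lipLimitNorm 𝒰 π ((lipLimitSubalgebra 𝒰 hF hπ).subtype.selfAdjointMap a) < ∞ :=
  coe_mem_lipLimitSubmodule.1 (a : lipLimitSubalgebra 𝒰 hF hπ).2

theorem IsLipLimit.exists_selfAdjointMap_eq {r : ℝ≥0} {z : selfAdjoint M}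
    (hz : IsLipLimit 𝒰 π r z) : ∃ a : selfAdjoint (lipLimitSubalgebra 𝒰 hF hπ),
      (lipLimitSubalgebra 𝒰 hF hπ).subtype.selfAdjointMap a = z :=
  ⟨⟨⟨z, coe_mem_lipLimitSubmodule.2 hz.lipLimitNorm_lt_top⟩, Subtype.ext z.2⟩, rfl⟩

variable [Nontrivial M] [∀ i, FiniteDimensional ℂ (x i).Alg]

theorem isQuasiLeibnizLipNorm_lipLimitNorm {K : ℝ} (hK : 0 ≤ K)
    (hx : ∀ i, (x i).stateDiam ≤ ENNReal.ofReal K) :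
    IsQuasiLeibnizLipNorm F fun a : selfAdjoint (lipLimitSubalgebra 𝒰 hF hπ) =>
      lipLimitNorm 𝒰 π ((lipLimitSubalgebra 𝒰 hF hπ).subtype.selfAdjointMap a) := by
  set σ := (lipLimitSubalgebra 𝒰 hF hπ).subtype
  have hσ : Function.Injective σ.selfAdjointMap := fun a b h =>
    Subtype.ext (Subtype.ext (congrArg (fun z : selfAdjoint M => (z : M)) h))
  refine isQuasiLeibnizLipNorm_of_finiteDimensional (K := K + 1) ?_ ?_ lipLimitNorm_subtype_lt_top
    ?_ ?_ ?_ ?_ ?_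
  · intro a b
    rw [map_add]
    exact lipLimitNorm_add_le _ _
  · intro r a
    have h : ∀ (r : ℝ) (a : selfAdjoint (lipLimitSubalgebra 𝒰 hF hπ)),
        lipLimitNorm 𝒰 π (σ.selfAdjointMap (r • a)) ≤
          ENNReal.ofReal |r| * lipLimitNorm 𝒰 π (σ.selfAdjointMap a) := fun r a => by
      rw [map_smul]
      exact lipLimitNorm_smul_le _ _ (lipLimitNorm_subtype_lt_top a)
    refine le_antisymm (h r a) ?_
    obtain rfl | hr := eq_or_ne r 0
    · simp
    · have h2 := h r⁻¹ (r • a)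
      rw [inv_smul_smul₀ hr, abs_inv, ENNReal.ofReal_inv_of_pos (abs_pos.2 hr)] at h2
      calc _ ≤ ENNReal.ofReal |r| * ((ENNReal.ofReal |r|)⁻¹ *
            lipLimitNorm 𝒰 π (σ.selfAdjointMap (r • a))) := by gcongr
        _ = _ := by
          rw [← mul_assoc, ENNReal.mul_inv_cancel (by simpa using hr) ENNReal.ofReal_ne_top, one_mul]
  · intro a
    rw [lipLimitNorm_eq_zero_iff hK hx]
    refine exists_congr fun t => ?_
    rw [← hσ.eq_iff, map_smul, StarAlgHom.selfAdjointMap_one]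
  · have h1 : {a | lipLimitNorm 𝒰 π (σ.selfAdjointMap a) ≤ 1} =
        σ.selfAdjointMap ⁻¹' {z | IsLipLimit 𝒰 π 1 z} := by
      ext a
      simpa using lipLimitNorm_le_iff hπ one_ne_zero
    rw [h1]
    exact (isClosed_isLipLimit hπ 1).preimage (StarAlgHom.continuous_selfAdjointMap _)
  · intro a ha
    have h1 : IsLipLimit 𝒰 π 1 (σ.selfAdjointMap a) :=
      (lipLimitNorm_le_iff hπ one_ne_zero).1 (by simpa using ha)
    obtain ⟨t, ht⟩ := h1.exists_norm_sub_le hK hx one_ne_zero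
    refine ⟨t, ?_⟩
    rw [NNReal.coe_one, one_mul, ← σ.selfAdjointMap_one, ← map_smul, ← map_sub] at ht
    exact ht
  · intro a b
    rw [StarAlgHom.selfAdjointMap_jordanProd]
    exact lipLimitNorm_prod_le hF hπ (P := fun A _ => jordanProd)
        (fun i => (π i).selfAdjointMap_jordanProd) continuous_jordanProd
        (fun i => (x i).isLipNorm.jordan_le) (lipLimitNorm_subtype_lt_top a)
        (lipLimitNorm_subtype_lt_top b)
  · intro a b
    rw [StarAlgHom.selfAdjointMap_lieProd]
    exact lipLimitNorm_prod_le hF hπ (P := fun A _ => lieProd)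
        (fun i => (π i).selfAdjointMap_lieProd) continuous_lieProd
        (fun i => (x i).isLipNorm.lie_le) (lipLimitNorm_subtype_lt_top a)
        (lipLimitNorm_subtype_lt_top b)

/-- The limit, along an ultrafilter, of quantum compact metric spaces which embed in a common
finite-dimensional C*-algebra. -/
noncomputable def lipLimitSpace (𝒰 : Ultrafilter ι) (hF : StronglyPermissible F)
    (hπ : ∀ i, Function.Injective (π i)) {K : ℝ} (hK : 0 ≤ K)
    (hx : ∀ i, (x i).stateDiam ≤ ENNReal.ofReal K) : QQCMS.{u} F where
  Alg := lipLimitSubalgebra 𝒰 hF hπ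
  L a := lipLimitNorm 𝒰 π ((lipLimitSubalgebra 𝒰 hF hπ).subtype.selfAdjointMap a)
  isLipNorm := isQuasiLeibnizLipNorm_lipLimitNorm hK hx

variable {K : ℝ} {hK : 0 ≤ K} {hx : ∀ i, (x i).stateDiam ≤ ENNReal.ofReal K}

variable (𝒰 hF hπ hK hx) in
/-- The embedding of the limit in the ambient algebra. -/
noncomputable def lipLimitSpaceHom : (lipLimitSpace 𝒰 hF hπ hK hx).Alg →⋆ₐ[ℂ] M :=
  (lipLimitSubalgebra 𝒰 hF hπ).subtype

theorem lipLimitSpaceHom_injective : Function.Injective (lipLimitSpaceHom 𝒰 hF hπ hK hx) :=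
  Subtype.val_injective

instance : FiniteDimensional ℂ (lipLimitSpace 𝒰 hF hπ hK hx).Alg :=
  inferInstanceAs (FiniteDimensional ℂ (lipLimitSubalgebra 𝒰 hF hπ))

theorem lipLimitSpace_L_le_iff {r : ℝ≥0} (hr : r ≠ 0)
    {a : selfAdjoint (lipLimitSpace 𝒰 hF hπ hK hx).Alg} :
    (lipLimitSpace 𝒰 hF hπ hK hx).L a ≤ r ↔
      IsLipLimit 𝒰 π r ((lipLimitSpaceHom 𝒰 hF hπ hK hx).selfAdjointMap a) :=
  lipLimitNorm_le_iff hπ hr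

theorem lipLimitSpace_L_le_one_iff {a : selfAdjoint (lipLimitSpace 𝒰 hF hπ hK hx).Alg} :
    (lipLimitSpace 𝒰 hF hπ hK hx).L a ≤ 1 ↔
      IsLipLimit 𝒰 π 1 ((lipLimitSpaceHom 𝒰 hF hπ hK hx).selfAdjointMap a) := by
  rw [← lipLimitSpace_L_le_iff one_ne_zero, ENNReal.coe_one]

/-- Two states of the limit have companions on some `x i`, and `a` is within `ε / 2` of an element
of the Lip-ball there. The difference of values changes by at most `ε`, so `K` itself survives. -/
theorem lipLimitSpace_stateDiam_le :
    (lipLimitSpace 𝒰 hF hπ hK hx).stateDiam ≤ ENNReal.ofReal K := by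
  refine iSup_le fun φ => iSup_le fun ψ => iSup₂_le fun a ha => ?_
  obtain ⟨c, hc, hlim⟩ := lipLimitSpace_L_le_one_iff.1 ha
  rw [edist_dist]
  refine ENNReal.ofReal_le_ofReal (le_of_forall_pos_le_add fun ε hε => ?_)
  obtain ⟨i, hi, hd⟩ := (hc.and (Metric.tendsto_nhds.1 hlim (ε / 2) (half_pos hε))).exists
  obtain ⟨φ', hφ⟩ := φ.exists_norm_sub_le lipLimitSpaceHom_injective (π i)
  obtain ⟨ψ', hψ⟩ := ψ.exists_norm_sub_le lipLimitSpaceHom_injective (π i)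
  have h1 : dist (φ'.1 (c i : (x i).Alg)) (ψ'.1 (c i : (x i).Alg)) ≤ K := by
    have h2 : edist (φ'.1 (c i : (x i).Alg)) (ψ'.1 (c i : (x i).Alg)) ≤ ENNReal.ofReal K :=
      (le_iSup₂ (f := fun (a : selfAdjoint (x i).Alg) (_ : (x i).L a ≤ 1) =>
        edist (φ'.1 (a : (x i).Alg)) (ψ'.1 (a : (x i).Alg))) (c i) (by exact_mod_cast hi)).trans
        ((le_iSup₂ (f := fun φ ψ => mongeKantorovich (x i).L φ ψ) φ' ψ').trans (hx i))
    rwa [edist_dist, ENNReal.ofReal_le_ofReal_iff hK] at h2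
  have h3 := hφ (c i) a
  have h4 := hψ (c i) a
  have h5 : ‖(lipLimitSpaceHom 𝒰 hF hπ hK hx) (a : (lipLimitSpace 𝒰 hF hπ hK hx).Alg) -
      π i (c i : (x i).Alg)‖ < ε / 2 := by
    rw [dist_comm, dist_eq_norm] at hd
    exact hd
  rw [← dist_eq_norm] at h3 h4
  rw [dist_comm] at h4
  have h6 := dist_triangle4 (φ.1 (a : (lipLimitSpace 𝒰 hF hπ hK hx).Alg))
    (φ'.1 (c i : (x i).Alg)) (ψ'.1 (c i : (x i).Alg))
    (ψ.1 (a : (lipLimitSpace 𝒰 hF hπ hK hx).Alg))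
  linarith

/-- Approximate a basis of the limit by elements of the `x i`; linear independence is open, so at
some index the approximants are independent. -/
theorem exists_finrank_lipLimitSpace_le :
    ∃ i, Module.finrank ℂ (lipLimitSpace 𝒰 hF hπ hK hx).Alg ≤ Module.finrank ℂ (x i).Alg := by
  set σ := lipLimitSpaceHom 𝒰 hF hπ hK hx
  have happrox : ∀ b : (lipLimitSpace 𝒰 hF hπ hK hx).Alg,
      ∃ s : ∀ i, (x i).Alg, Tendsto (fun i => π i (s i)) 𝒰 (𝓝 (σ b)) := by
    intro b
    have hmem : σ b ∈ lipLimitSubmodule 𝒰 π := Subtype.property (p := (· ∈ lipLimitSubalgebra 𝒰 hF hπ)) b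
    obtain ⟨s, -, hs⟩ := isLipLimit_toNNReal_add hmem.1 one_pos
    obtain ⟨t, -, ht⟩ := isLipLimit_toNNReal_add hmem.2 one_pos
    refine ⟨fun i => s i + Complex.I • (t i : (x i).Alg), ?_⟩
    have h := ((continuous_subtype_val.tendsto _).comp hs).add
      (((continuous_subtype_val.tendsto _).comp ht).const_smul Complex.I)
    rw [realPart_add_I_smul_imaginaryPart] at h
    refine h.congr fun i => ?_
    simp
  let e := Module.finBasis ℂ (lipLimitSpace 𝒰 hF hπ hK hx).Alg
  choose s hs using happrox
  have hlim : Tendsto (fun i k => π i (s (e k) i)) 𝒰 (𝓝 fun k => σ (e k)) :=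
    tendsto_pi_nhds.2 fun k => hs (e k)
  have hli : LinearIndependent ℂ fun k => σ (e k) :=
    e.linearIndependent.map' σ.toAlgHom.toLinearMap
      (LinearMap.ker_eq_bot.2 lipLimitSpaceHom_injective)
  obtain ⟨i, hi⟩ := (hlim.eventually (isOpen_setOfPred_linearIndependent.mem_nhds hli)).exists
  have h2 : LinearIndependent ℂ fun k => s (e k) i :=
    LinearIndependent.of_comp (π i).toAlgHom.toLinearMap hi
  exact ⟨i, by simpa using h2.fintype_card_le_finrank⟩

/-- The Lip-balls converge, along the ultrafilter, to that of the limit space. -/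
theorem eventually_lipBall_close {ε : ℝ≥0} (hε : 0 < ε) : ∀ᶠ i in 𝒰,
    (∀ a, (x i).L a ≤ 1 → ∃ b, (lipLimitSpace 𝒰 hF hπ hK hx).L b ≤ 1 ∧
      ‖(π i).selfAdjointMap a - (lipLimitSpaceHom 𝒰 hF hπ hK hx).selfAdjointMap b‖₊ ≤ ε) ∧
    ∀ b, (lipLimitSpace 𝒰 hF hπ hK hx).L b ≤ 1 → ∃ a, (x i).L a ≤ 1 ∧
      ‖(π i).selfAdjointMap a - (lipLimitSpaceHom 𝒰 hF hπ hK hx).selfAdjointMap b‖₊ ≤ ε := by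
  set σ := lipLimitSpaceHom 𝒰 hF hπ hK hx
  have : ProperSpace (selfAdjoint M) := FiniteDimensional.proper ℝ _
  have hε' : (0 : ℝ) < ε := by exact_mod_cast hε
  rw [eventually_and]
  constructor
  · by_contra hcon
    rw [← Ultrafilter.frequently_iff_eventually, not_frequently] at hcon
    -- A counterexample is chosen wherever the claim fails, and zero elsewhere.
    have hchoose : ∀ i, ∃ a, (x i).L a ≤ 1 ∧ ((¬ ∀ a, (x i).L a ≤ 1 →
        ∃ b, (lipLimitSpace 𝒰 hF hπ hK hx).L b ≤ 1 ∧
          ‖(π i).selfAdjointMap a - σ.selfAdjointMap b‖₊ ≤ ε) →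
        ∀ b, (lipLimitSpace 𝒰 hF hπ hK hx).L b ≤ 1 →
          ¬ ‖(π i).selfAdjointMap a - σ.selfAdjointMap b‖₊ ≤ ε) := by
      intro i
      by_cases h : ∀ a, (x i).L a ≤ 1 → ∃ b, (lipLimitSpace 𝒰 hF hπ hK hx).L b ≤ 1 ∧
          ‖(π i).selfAdjointMap a - σ.selfAdjointMap b‖₊ ≤ ε
      · exact ⟨(0 : ℝ) • 1, by simp only [QQCMS.L_smul_one, zero_le], fun h' => absurd h h'⟩
      · push Not at h
        obtain ⟨a, ha, hb⟩ := h
        exact ⟨a, ha, fun _ b hb' => not_le.2 (hb b hb')⟩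
    choose a ha hbad using hchoose
    -- The Lip-balls are unbounded along the scalars. Subtracting `t i • 1` gives a bounded family
    -- with a limit `z`; at one bad index the scalar is added back to `z`, which contradicts the
    -- choice.
    choose t ht using fun i => (x i).norm_sub_le (hx i) hK (ha i)
    obtain ⟨z, hz⟩ := 𝒰.exists_tendsto_of_norm_le
      (s := fun i => (π i).selfAdjointMap (a i - t i • 1)) (C := K)
      (.of_forall fun i => (StarAlgHom.norm_selfAdjointMap (hπ i) _).trans_le (ht i))
    have hz1 : IsLipLimit 𝒰 π 1 z := ⟨_, .of_forall fun i => by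
      rw [sub_eq_add_neg, ← neg_smul]
      refine ((x i).isLipNorm.add_le _ _).trans ?_
      rw [QQCMS.L_smul_one, add_zero]
      exact_mod_cast ha i, hz⟩
    obtain ⟨i, hi, hd⟩ := (hcon.and (Metric.tendsto_nhds.1 hz ε hε')).exists
    have hz2 := hz1.add_smul_one (t i)
    obtain ⟨b, hb⟩ := hz2.exists_selfAdjointMap_eq (hF := hF) (hπ := hπ)
    have hb' : σ.selfAdjointMap b = z + t i • 1 := hb
    refine hbad i hi b (lipLimitSpace_L_le_one_iff.2 (hb' ▸ hz2)) ?_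
    rw [hb', ← NNReal.coe_le_coe, coe_nnnorm]
    rw [dist_eq_norm, map_sub, map_smul, StarAlgHom.selfAdjointMap_one, sub_right_comm, sub_sub] at hd
    exact hd.le
  · by_contra hcon
    rw [← Ultrafilter.frequently_iff_eventually, not_frequently] at hcon
    have hchoose : ∀ i, ∃ b, (lipLimitSpace 𝒰 hF hπ hK hx).L b ≤ 1 ∧ ((¬ ∀ b,
        (lipLimitSpace 𝒰 hF hπ hK hx).L b ≤ 1 → ∃ a, (x i).L a ≤ 1 ∧
          ‖(π i).selfAdjointMap a - σ.selfAdjointMap b‖₊ ≤ ε) →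
        ∀ a, (x i).L a ≤ 1 → ¬ ‖(π i).selfAdjointMap a - σ.selfAdjointMap b‖₊ ≤ ε) := by
      intro i
      by_cases h : ∀ b, (lipLimitSpace 𝒰 hF hπ hK hx).L b ≤ 1 → ∃ a, (x i).L a ≤ 1 ∧
          ‖(π i).selfAdjointMap a - σ.selfAdjointMap b‖₊ ≤ ε
      · exact ⟨(0 : ℝ) • 1, by simp only [QQCMS.L_smul_one, zero_le], fun h' => absurd h h'⟩
      · push Not at h
        obtain ⟨a, ha, hb⟩ := h
        exact ⟨a, ha, fun _ b hb' => not_le.2 (hb b hb')⟩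
    choose b hb hbad using hchoose
    choose t ht using fun i => (lipLimitSpace_L_le_one_iff.1 (hb i)).exists_norm_sub_le hK hx one_ne_zero
    obtain ⟨z, hz⟩ := 𝒰.exists_tendsto_of_norm_le
      (s := fun i => σ.selfAdjointMap (b i) - t i • 1) (.of_forall ht)
    -- Here the bad elements lie in the limit ball. Closedness keeps `z` in it, so `z` is itself
    -- approximated by elements `c i` of the Lip-balls, and `c i + t i • 1` is close to `b i`.
    have hz1 : IsLipLimit 𝒰 π 1 z := (isClosed_isLipLimit hπ 1).mem_of_tendsto hz
      (.of_forall fun i => by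
        have := (lipLimitSpace_L_le_one_iff.1 (hb i)).add_smul_one (-t i)
        rwa [neg_smul, ← sub_eq_add_neg] at this)
    obtain ⟨c, hc, hcz⟩ := hz1
    obtain ⟨i, hi, hci, hd⟩ := (hcon.and (hc.and (Metric.tendsto_nhds.1 (hcz.sub hz) ε hε'))).exists
    refine hbad i hi (c i + t i • 1) ?_ ?_
    · refine ((x i).isLipNorm.add_le _ _).trans ?_
      rw [QQCMS.L_smul_one, add_zero]
      exact_mod_cast hci
    · rw [sub_self, dist_zero_right] at hd
      rw [← NNReal.coe_le_coe, coe_nnnorm, map_add, map_smul, StarAlgHom.selfAdjointMap_one,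
        add_sub_right_comm, sub_add]
      exact hd.le

end LimitSpace

/-! ### Ultrafilter limits in the class -/

section Compactness

/-- Homogeneity identifies the limit Lip-norm with the Minkowski functional of the limit ball. -/
theorem isLipLimit_iff_mem_smul {ι : Type*} {𝒰 : Ultrafilter ι} {x : ι → QQCMS.{u} F} {M : Type u}
    [CStarAlgebra M] {π : ∀ i, (x i).Alg →⋆ₐ[ℂ] M} {r : ℝ≥0} (hr : r ≠ 0) {z : selfAdjoint M} :
    IsLipLimit 𝒰 π r z ↔ ∃ w, IsLipLimit 𝒰 π 1 w ∧ (r : ℝ) • w = z := by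
  have hr' : (r : ℝ) ≠ 0 := by exact_mod_cast hr
  constructor
  · intro h
    refine ⟨(r : ℝ)⁻¹ • z, ?_, smul_inv_smul₀ hr' z⟩
    have := h.smul (r : ℝ)⁻¹
    rwa [nnnorm_inv, NNReal.nnnorm_eq, inv_mul_cancel₀ hr] at this
  · rintro ⟨w, hw, rfl⟩
    simpa using hw.smul (r : ℝ)

theorem Isometry.isClosed_image_selfAdjoint {M E : Type*} [CStarAlgebra M] [FiniteDimensional ℂ M]
    [MetricSpace E] {f : selfAdjoint M → E} (hf : Isometry f) {s : Set (selfAdjoint M)} (hs : IsClosed s) :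
    IsClosed (f '' s) := by
  have : CompleteSpace (selfAdjoint M) := FiniteDimensional.complete ℝ _
  exact hf.isClosedEmbedding.isClosedMap _ hs

theorem mem_boundedClass_iff {K : ℝ} {d : ℕ} {X : QQCMS.{u} F} : X ∈ boundedClass F K d ↔
    FiniteDimensional ℂ X.Alg ∧ Module.finrank ℂ X.Alg ≤ d ∧ X.stateDiam ≤ ENNReal.ofReal K := by
  rw [← and_assoc]
  refine and_congr_left fun _ => ⟨fun h => ?_, fun ⟨_, h⟩ => ?_⟩
  · have : FiniteDimensional ℂ X.Alg :=
      Module.rank_lt_aleph0_iff.1 (h.trans_lt Cardinal.natCast_lt_aleph0)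
    refine ⟨this, ?_⟩
    rw [← Module.finrank_eq_rank] at h
    exact_mod_cast h
  · rw [← Module.finrank_eq_rank]
    exact_mod_cast h

instance {N : Type*} [Finite N] : FiniteDimensional ℂ (CStarMatrix N N ℂ) :=
  Module.Finite.equiv (CStarMatrix.ofMatrixₗ (R := ℂ) (m := N) (n := N) (A := ℂ))

theorem CStarMatrix.real_smul_eq {N : Type*} (r : ℝ) (z : CStarMatrix N N ℂ) :
    r • z = (r : ℂ) • z := by
  ext i j
  simp

/-- Spaces of a fixed finite dimension have a limit along every ultrafilter. -/
theorem exists_ultrafilter_limit_of_finrank_eq {ι : Type*} (𝒰 : Ultrafilter ι)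
    (hF : StronglyPermissible F) {d m : ℕ} (hm : m ≤ d) {K : ℝ} (hK : 0 ≤ K) (x : ι → QQCMS.{u} F)
    [∀ i, FiniteDimensional ℂ (x i).Alg] (hx : ∀ i, (x i).stateDiam ≤ ENNReal.ofReal K)
    (hdim : ∀ i, Module.finrank ℂ (x i).Alg = m) :
    ∃ Y ∈ boundedClass F K d, ∃ (p : ∀ i, (x i).Alg →⋆ₙₐ[ℂ] CStarMatrix (Fin d) (Fin d) ℂ)
      (ρ : Y.Alg →⋆ₙₐ[ℂ] CStarMatrix (Fin d) (Fin d) ℂ) (S : Set (CStarMatrix (Fin d) (Fin d) ℂ)),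
      Function.Injective ρ ∧ IsClosed S ∧ S ⊆ ρ '' {a | IsSelfAdjoint a} ∧
      (∀ a : selfAdjoint Y.Alg,
        Y.L a = ⨅ (r : ℝ≥0) (_ : 0 < r ∧ ρ (a : Y.Alg) ∈ (r : ℝ) • S), (r : ℝ≥0∞)) ∧
      (∀ i, Function.Injective (p i) ∧ p i 1 = ρ 1) ∧
      ∀ ε : ℝ≥0, 0 < ε → ∀ᶠ i in 𝒰, propinquity (x i) Y ≤ ε ∧ propinquity Y (x i) ≤ ε ∧
        Metric.hausdorffEDist ((x i).lipBallImage (p i)) S ≤ ε := by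
  -- The lift places the ambient matrix algebra in the universe of the spaces.
  let N := ULift.{u} (Fin m)
  have hcard : Fintype.card N = m := by simp [N]
  obtain ⟨i₀⟩ : Nonempty ι := 𝒰.neBot.nonempty
  have hm0 : 0 < m := hdim i₀ ▸ Module.finrank_pos
  have : Nonempty N := ⟨⟨⟨0, hm0⟩⟩⟩
  choose π hπ using fun i =>
    exists_injective_starAlgHom_cstarMatrix (A := (x i).Alg) (N := N) (by rw [hcard, hdim])
  obtain ⟨j, hj⟩ := exists_corner_embedding
    (Equiv.ulift.toEmbedding.trans (Fin.castLEEmb hm) : N ↪ Fin d)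
  have hjiso : Isometry j := NonUnitalStarAlgHom.isometry j hj
  have hjsmul : ∀ (r : ℝ) (z : CStarMatrix N N ℂ), j (r • z) = r • j z := fun r z => by
    rw [CStarMatrix.real_smul_eq, map_smul, CStarMatrix.real_smul_eq]
  let Y := lipLimitSpace 𝒰 hF hπ hK hx
  let σ : Y.Alg →⋆ₐ[ℂ] CStarMatrix N N ℂ := lipLimitSpaceHom 𝒰 hF hπ hK hx
  have hσ : Function.Injective σ := lipLimitSpaceHom_injective
  have hYdiam : Y.stateDiam ≤ ENNReal.ofReal K := lipLimitSpace_stateDiam_le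
  have hYfin : FiniteDimensional ℂ Y.Alg :=
    inferInstanceAs (FiniteDimensional ℂ (lipLimitSpace 𝒰 hF hπ hK hx).Alg)
  refine ⟨Y, mem_boundedClass_iff.2 ⟨hYfin, ?_, hYdiam⟩,
    fun i => j.comp (π i).toNonUnitalStarAlgHom, j.comp σ.toNonUnitalStarAlgHom,
    (fun z : selfAdjoint (CStarMatrix N N ℂ) => j z) '' {z | IsLipLimit 𝒰 π 1 z},
    hj.comp hσ, ?_, ?_, ?_, fun i => ⟨hj.comp (hπ i), ?_⟩, fun ε hε => ?_⟩
  · obtain ⟨i, hi⟩ := exists_finrank_lipLimitSpace_le (𝒰 := 𝒰) (hF := hF) (hπ := hπ) (hK := hK)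
      (hx := hx)
    exact hi.trans ((hdim i).trans_le hm)
  · have hiso : Isometry fun z : selfAdjoint (CStarMatrix N N ℂ) => j z :=
      hjiso.comp isometry_subtype_coe
    exact hiso.isClosed_image_selfAdjoint (isClosed_isLipLimit hπ 1)
  · rintro _ ⟨z, hz, rfl⟩
    obtain ⟨a, ha⟩ := IsLipLimit.exists_selfAdjointMap_eq (hF := hF) (hπ := hπ) hz
    exact ⟨a.1, a.2, congrArg (fun z : selfAdjoint (CStarMatrix N N ℂ) => j z) ha⟩
  · intro a
    refine iInf_congr fun r => iInf_congr_Prop (and_congr_right fun hr => ?_) fun _ => rfl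
    rw [isLipLimit_iff_mem_smul hr.ne']
    constructor
    · rintro ⟨w, hw, h⟩
      refine ⟨_, ⟨w, hw, rfl⟩, ?_⟩
      change (r : ℝ) • j w = j (σ a)
      rw [← hjsmul]
      exact congrArg (fun z : selfAdjoint (CStarMatrix N N ℂ) => j z) h
    · rintro ⟨_, ⟨w, hw, rfl⟩, h⟩
      change (r : ℝ) • j w = j (σ a) at h
      rw [← hjsmul] at h
      exact ⟨w, hw, Subtype.ext (hj h)⟩
  · change j (π i 1) = j (σ 1)
    rw [map_one (π i), map_one σ]
  · filter_upwards [eventually_lipBall_close (𝒰 := 𝒰) (hF := hF) (hπ := hπ) (hK := hK)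
      (hx := hx) hε] with i hi
    obtain ⟨h1, h2⟩ := hi
    have hprop : propinquity (x i) Y ≤ ε :=
      propinquity_le_of_lipBall hF.toPermissible hK (hx i) hYdiam (hπ i) hσ hε.ne' h1 h2
    refine ⟨hprop, (propinquity_comm_le _ _).trans hprop, ?_⟩
    have hed : ∀ (a : selfAdjoint (x i).Alg) (b : selfAdjoint Y.Alg),
        ‖(π i).selfAdjointMap a - σ.selfAdjointMap b‖₊ ≤ ε →
        edist (j (π i (a : (x i).Alg))) (j (σ (b : Y.Alg))) ≤ ε := fun a b h => by
      rw [hjiso.edist_eq, edist_eq_enorm_sub]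
      exact ENNReal.coe_le_coe.2 h
    refine Metric.hausdorffEDist_le_of_mem_edist ?_ ?_
    · rintro _ ⟨a, ha, rfl⟩
      obtain ⟨b, hb, hab⟩ := h1 a ha
      exact ⟨_, ⟨σ.selfAdjointMap b, lipLimitSpace_L_le_one_iff.1 hb, rfl⟩, hed a b hab⟩
    · rintro _ ⟨z, hz, rfl⟩
      obtain ⟨b, rfl⟩ := IsLipLimit.exists_selfAdjointMap_eq (hF := hF) (hπ := hπ) hz
      obtain ⟨a, ha, hab⟩ := h2 b (lipLimitSpace_L_le_one_iff.2 hz)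
      refine ⟨_, ⟨a, ha, rfl⟩, ?_⟩
      rw [edist_comm]
      exact hed a b hab

/-- Every ultrafilter on the class of spaces of bounded dimension and diameter has a limit, for the
dual propinquity and for the Hausdorff distance of the Lip-balls in a matrix algebra. -/
theorem exists_ultrafilter_limit {ι : Type*} (𝒰 : Ultrafilter ι) (hF : StronglyPermissible F)
    {d : ℕ} {K : ℝ} (hK : 0 ≤ K) (x : ι → QQCMS.{u} F)
    (hx : ∀ᶠ i in 𝒰, x i ∈ boundedClass F K d) :
    ∃ Y ∈ boundedClass F K d, ∃ (p : ∀ i, (x i).Alg →⋆ₙₐ[ℂ] CStarMatrix (Fin d) (Fin d) ℂ)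
      (ρ : Y.Alg →⋆ₙₐ[ℂ] CStarMatrix (Fin d) (Fin d) ℂ) (S : Set (CStarMatrix (Fin d) (Fin d) ℂ)),
      Function.Injective ρ ∧ IsClosed S ∧ S ⊆ ρ '' {a | IsSelfAdjoint a} ∧
      (∀ a : selfAdjoint Y.Alg,
        Y.L a = ⨅ (r : ℝ≥0) (_ : 0 < r ∧ ρ (a : Y.Alg) ∈ (r : ℝ) • S), (r : ℝ≥0∞)) ∧
      ∀ ε : ℝ≥0, 0 < ε → ∀ᶠ i in 𝒰, (Function.Injective (p i) ∧ p i 1 = ρ 1) ∧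
        propinquity (x i) Y ≤ ε ∧ propinquity Y (x i) ≤ ε ∧
        Metric.hausdorffEDist ((x i).lipBallImage (p i)) S ≤ ε := by
  classical
  have hcover : (⋃ m ∈ Set.Iic d, {i | x i ∈ boundedClass F K d ∧ Module.finrank ℂ (x i).Alg = m}) ∈
      𝒰 := by
    filter_upwards [hx] with i hi
    exact Set.mem_iUnion₂.2 ⟨_, (mem_boundedClass_iff.1 hi).2.1, hi, rfl⟩
  -- The class is a finite union over dimensions, so the ultrafilter selects one of them.
  obtain ⟨m, hm, hJ⟩ := (Ultrafilter.finite_biUnion_mem_iff (Set.finite_Iic d)).1 hcover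
  set J := {i | x i ∈ boundedClass F K d ∧ Module.finrank ℂ (x i).Alg = m}
  have hrange : Set.range (Subtype.val : J → ι) ∈ 𝒰 := by simpa using hJ
  have : ∀ i : J, FiniteDimensional ℂ (x i).Alg := fun i => (mem_boundedClass_iff.1 i.2.1).1
  obtain ⟨Y, hY, p, ρ, S, h1, h2, h3, h4, h5, h6⟩ := exists_ultrafilter_limit_of_finrank_eq
    (𝒰.comap Subtype.val_injective hrange) hF hm hK (fun i : J => x i) (fun i => i.2.1.2)
    (fun i => i.2.2)
  refine ⟨Y, hY, fun i => if h : i ∈ J then p ⟨i, h⟩ else 0, ρ, S, h1, h2, h3, h4, fun ε hε => ?_⟩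
  filter_upwards [(Ultrafilter.mem_comap _ _ _).1 (Ultrafilter.mem_coe.1 (h6 ε hε))] with i hi
  obtain ⟨k, hk, rfl⟩ := hi
  rw [dif_pos k.2]
  exact ⟨h5 k, hk⟩

end Compactness

end

/-! ### Compactness and convergent subsequences -/

theorem mainTheorem3 (F : ℝ≥0 × ℝ≥0 × ℝ≥0 × ℝ≥0 → ℝ≥0) (hF : StronglyPermissible F)
    (d : ℕ) (hd : 1 ≤ d) (K : ℝ) (hK : 0 < K) :
    @IsCompact (QQCMS.{u} F) (propinquityTopology F) (boundedClass F K d) ∧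
    ∀ x : ℕ → QQCMS.{u} F, (∀ n, x n ∈ boundedClass F K d) →
      ∃ g : ℕ → ℕ, StrictMono g ∧ ∃ Y ∈ boundedClass F K d,
        Tendsto (fun n => propinquity (x (g n)) Y) atTop (𝓝 0) ∧
        IsMatrixHausdorffLimit d (fun n => x (g n)) Y := by
  constructor
  · let _ := propinquityTopology F
    refine isCompact_iff_ultrafilter_le_nhds.2 fun f hf => ?_
    obtain ⟨Y, hY, _, _, _, _, _, _, _, h⟩ :=
      exists_ultrafilter_limit f hF hK.le id (le_principal_iff.1 hf)
    refine ⟨Y, hY, le_nhds_iff.2 fun U hYU hU => ?_⟩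
    obtain ⟨ε, hε, hball⟩ := hU Y hYU
    obtain ⟨δ, hδ, hδε⟩ := ENNReal.lt_iff_exists_nnreal_btwn.1 hε
    filter_upwards [h δ (by exact_mod_cast hδ)] with X hX
    exact hball X (hX.2.2.1.trans_lt hδε)
  · intro x hx
    obtain ⟨Y, hY, p, ρ, S, h1, h2, h3, h4, h5⟩ := exists_ultrafilter_limit (hyperfilter ℕ) hF hK.le
      x (.of_forall hx)
    -- What holds eventually along a nonprincipal ultrafilter holds for infinitely many indices, so
    -- a strictly increasing `g` can meet the tolerance `1 / (n + 1)` at step `n`, for the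
    -- propinquity and for the balls together.
    obtain ⟨g, hg, hP⟩ := extraction_forall_of_frequently (P := fun n k =>
      (Function.Injective (p k) ∧ p k 1 = ρ 1) ∧ propinquity (x k) Y ≤ ((n + 1 : ℕ) : ℝ≥0)⁻¹ ∧
        propinquity Y (x k) ≤ ((n + 1 : ℕ) : ℝ≥0)⁻¹ ∧
        Metric.hausdorffEDist ((x k).lipBallImage (p k)) S ≤ ((n + 1 : ℕ) : ℝ≥0)⁻¹)
      fun n => (h5 (((n + 1 : ℕ) : ℝ≥0)⁻¹) (by positivity)).frequently.filter_mono
        Nat.hyperfilter_le_atTop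
    have hlim : Tendsto (fun n : ℕ => ((((n + 1 : ℕ) : ℝ≥0)⁻¹ : ℝ≥0) : ℝ≥0∞)) atTop (𝓝 0) := by
      refine (ENNReal.tendsto_inv_nat_nhds_zero.comp (tendsto_add_atTop_nat 1)).congr fun n => ?_
      rw [ENNReal.coe_inv (by positivity), ENNReal.coe_natCast]
      rfl
    refine ⟨g, hg, Y, hY, ?_, fun n => p (g n), ρ, S, fun n => (hP n).1.1, h1, fun n => (hP n).1.2,
      h2, h3, ?_, h4⟩
    · exact tendsto_of_tendsto_of_tendsto_of_le_of_le tendsto_const_nhds hlim (fun _ => zero_le)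
        fun n => (hP n).2.1
    · exact tendsto_of_tendsto_of_tendsto_of_le_of_le tendsto_const_nhds hlim (fun _ => zero_le)
        fun n => (hP n).2.2.2
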